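/- Let $G$ be a second-countable locally compact (Hausdorff) unimodular group with Haar measure $\mu_G$, and let $Q\subseteq G$ be a fixed compact symmetric neighbourhood of the identity. A *Følner sequence* is a sequence $(K_n)_{n\in\mathbb N}$ of non-null compact subsets of $G$ with $\mu_G(K_nK\,\triangle\,K_n)/\mu_G(K_n)\to 0$ for every non-empty compact $K\subseteq G$; it is a *strong Følner sequence* if moreover $\mu_G(K_nK\cap K_n^cK)/\mu_G(K_n)\to 0$ for every compact $K\subseteq G$. Assume that $G$ is amenable, i.e. that it admits a Følner sequence. For a discrete set $\Lambda\subseteq G$ put $$D^-(\Lambda)=\lim_{n\to\infty}\inf_{x\in G}\frac{\#(\Lambda\cap xK_n)}{\mu_G(K_n)},\qquad D^+(\Lambda)=\lim_{n\to\infty}\sup_{x\in G}\frac{\#(\Lambda\cap xK_n)}{\mu_G(K_n)},$$ where $(K_n)$ is any strong Følner sequence. Let $(\pi,\mathcal H_\pi)$ be a projective unitary representation of $G$ on a complex Hilbert space, that is, a strongly measurable map $\pi:G\to\mathcal U(\mathcal H_\pi)$ with $\pi(xy)=\sigma(x,y)\pi(x)\pi(y)$ for some $\sigma:G\times G\to\mathbb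 T$. Write $V_gf(x)=\langle f,\pi(x)g\rangle$. Assume that $\pi$ is irreducible (the only closed invariant subspaces are $\{0\}$ and $\mathcal H_\pi$) and square-integrable ($V_gg\in L^2(G)$ for some $g\neq 0$). Its formal degree is the number $d_\pi>0$ such that, for all $f_1,f_2,g_1,g_2\in\mathcal H_\pi$, $$\int_G\langle f_1,\pi(x)g_1\rangle\langle\pi(x)g_2,f_2\rangle\,d\mu_G(x)=d_\pi^{-1}\langle f_1,f_2\rangle\overline{\langle g_1,g_2\rangle}.$$ Let $\mathcal B^2_\pi$ be the set of all $g\in\mathcal H_\pi$ such that $V_gg\in L^\infty_{\mathrm{loc}}(G)$ and the function $x\mapsto\operatorname{ess\,sup}_{z\in Q}|V_gg(xz)|$ belongs to $L^2(G)$. **Corollary.** Let $\Lambda\subseteq G$ be discrete and $g\in\mathcal B^2_\pi$, and suppose that $(\pi(\lambda)g)_{\lambda\in\Lambda}$ is a frame for $\mathcal H_\pi$ with frame bounds $A,B>0$, i.e. $$A\|f\|^2\le\sum_{\lambda\in\Lambda}|\langle f,\pi(\lambda)g\rangle|^2\le B\|f\|^2\qquad\text{for all } f\in\mathcal H_\pi.$$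 Then the formal degree $d_\pi$ exists, strong Følner sequences exist, the limits $D^-(\Lambda)$ and $D^+(\Lambda)$ exist, are finite and do not depend on the strong Følner sequence, and $$A\le d_\pi^{-1}D^-(\Lambda)\|g\|^2\le d_\pi^{-1}D^+(\Lambda)\|g\|^2\le B.$$ In particular, if $A=B$, then $D^-(\Lambda)=D^+(\Lambda)$. -/

import Mathlib

open MeasureTheory Filter Topology
open scoped Pointwise ENNReal NNReal

namespace CoherentFrame

/-! ### Følner sequences and Beurling density -/

section Density

variable {G : Type*} [Group G] [TopologicalSpace G] [MeasurableSpace G]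

/-- A (right) Følner sequence: non-null compact sets `K n` with
`μ (K n * C ∆ K n) / μ (K n) → 0` for every non-empty compact set `C`. -/
structure IsFolner (μ : Measure G) (K : ℕ → Set G) : Prop where
  isCompact : ∀ n, IsCompact (K n)
  measure_ne_zero : ∀ n, μ (K n) ≠ 0
  tendsto_symmDiff : ∀ C : Set G, IsCompact C → C.Nonempty →
    Tendsto (fun n => μ (symmDiff (K n * C) (K n)) / μ (K n)) atTop (𝓝 0)

/-- A (right) strong Følner sequence: a Følner sequence such that moreover
`μ (K n * C ∩ (K n)ᶜ * C) / μ (K n) → 0` for every compact set `C`. -/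
structure IsStrongFolner (μ : Measure G) (K : ℕ → Set G) : Prop extends IsFolner μ K where
  tendsto_boundary : ∀ C : Set G, IsCompact C →
    Tendsto (fun n => μ ((K n * C) ∩ ((K n)ᶜ * C)) / μ (K n)) atTop (𝓝 0)

/-- The group, with Haar measure `μ`, is amenable: it admits a Følner sequence. -/
def IsAmenable (μ : Measure G) : Prop := ∃ K : ℕ → Set G, IsFolner μ K

/-- `D` is the lower Beurling density of `Λ`: strong Følner sequences exist, and
`inf_x #(Λ ∩ x K n) / μ (K n)` converges to `D` along each of them. -/
def HasLowerDensity (μ : Measure G) (Λ : Set G) (D : ℝ≥0) : Prop :=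
  (∃ K : ℕ → Set G, IsStrongFolner μ K) ∧
  ∀ K : ℕ → Set G, IsStrongFolner μ K →
    Tendsto (fun n => ⨅ x : G, ((Λ ∩ x • K n).encard : ℝ≥0∞) / μ (K n)) atTop (𝓝 (D : ℝ≥0∞))

/-- `D` is the upper Beurling density of `Λ`: strong Følner sequences exist, and
`sup_x #(Λ ∩ x K n) / μ (K n)` converges to `D` along each of them. -/
def HasUpperDensity (μ : Measure G) (Λ : Set G) (D : ℝ≥0) : Prop :=
  (∃ K : ℕ → Set G, IsStrongFolner μ K) ∧
  ∀ K : ℕ → Set G, IsStrongFolner μ K →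
    Tendsto (fun n => ⨆ x : G, ((Λ ∩ x • K n).encard : ℝ≥0∞) / μ (K n)) atTop (𝓝 (D : ℝ≥0∞))

end Density

/-! ### Local maximal functions and Wiener amalgam spaces -/

section Amalgam

variable {G : Type*} [Group G] [TopologicalSpace G] [MeasurableSpace G]

/-- The left local maximal function `x ↦ ess sup_{z ∈ Q} |F (x z)|`, with values in `[0, ∞]`. -/
noncomputable def localMaximal (μ : Measure G) (Q : Set G) (F : G → ℂ) (x : G) : ℝ≥0∞ :=
  essSup (fun z => ‖F (x * z)‖ₑ) (μ.restrict Q)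

/-- Membership in `W^L(L^p)`: the function `F` lies in `L^∞_loc` and its left local maximal
function lies in `L^p`. -/
structure MemAmalgam (μ : Measure G) (Q : Set G) (p : ℝ≥0∞) (F : G → ℂ) : Prop where
  aestronglyMeasurable : AEStronglyMeasurable F μ
  locally_bounded : ∀ C : Set G, IsCompact C → essSup (fun x => ‖F x‖ₑ) (μ.restrict C) < ∞
  memLp : MemLp (localMaximal μ Q F) p μ

end Amalgam

/-! ### Projective unitary representations -/

/-- A projective unitary representation: a strongly measurable map `π` from `G` to the unitary
operators of `H` with `π (x y) = σ x y • π x ∘ π y`, where `σ` is circle-valued. -/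
structure ProjRep (G H : Type*) [Group G] [MeasurableSpace G]
    [NormedAddCommGroup H] [InnerProductSpace ℂ H] where
  /-- the operators -/
  op : G → (H ≃ₗᵢ[ℂ] H)
  /-- the cocycle -/
  σ : G → G → Circle
  map_mul : ∀ (x y : G) (f : H), op (x * y) f = (σ x y : ℂ) • op x (op y f)
  stronglyMeasurable : ∀ f : H, StronglyMeasurable (fun x => op x f)

namespace ProjRep

variable {G H : Type*} [Group G] [TopologicalSpace G] [MeasurableSpace G]
  [NormedAddCommGroup H] [InnerProductSpace ℂ H]

/-- The coefficient transform `V_g f (x) = ⟨f, π(x) g⟩`, where `⟨·, ·⟩` is linear in its first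
argument (Mathlib's `inner` is linear in its second). -/
noncomputable def coeff (π : ProjRep G H) (g f : H) (x : G) : ℂ := inner ℂ (π.op x g) f

/-- The only closed invariant subspaces are `{0}` and `H`. -/
def IsIrreducible (π : ProjRep G H) : Prop :=
  ∀ W : Submodule ℂ H, IsClosed (W : Set H) → (∀ x : G, ∀ f ∈ W, π.op x f ∈ W) →
    W = ⊥ ∨ W = ⊤

/-- A discrete series (irreducible square-integrable) representation. -/
def IsDiscreteSeries (μ : Measure G) (π : ProjRep G H) : Prop :=
  π.IsIrreducible ∧ ∃ g : H, g ≠ 0 ∧ MemLp (π.coeff g g) 2 μ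

/-- `d` is the formal degree of `π`: the positive number for which the orthogonality relations
`∫ ⟨f₁, π(x) g₁⟩ ⟨π(x) g₂, f₂⟩ dμ(x) = d⁻¹ ⟨f₁, f₂⟩ conj ⟨g₁, g₂⟩` hold (brackets linear in
the first argument). -/
def IsFormalDegree (μ : Measure G) (π : ProjRep G H) (d : ℝ) : Prop :=
  0 < d ∧ ∀ f₁ f₂ g₁ g₂ : H,
    Integrable (fun x => inner ℂ (π.op x g₁) f₁ * inner ℂ f₂ (π.op x g₂)) μ ∧
    ∫ x, inner ℂ (π.op x g₁) f₁ * inner ℂ f₂ (π.op x g₂) ∂μ =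
      (d : ℂ)⁻¹ * inner ℂ f₂ f₁ * (starRingEnd ℂ) (inner ℂ g₂ g₁)

/-- The set `B²_π` of all `g` with `V_g g ∈ W^L(L²)`. -/
def B2 (μ : Measure G) (Q : Set G) (π : ProjRep G H) : Set H :=
  {g | MemAmalgam μ Q 2 (π.coeff g g)}

/-- `(π(l) g)_{l ∈ Λ}` is a frame for `H` with frame bounds `A` and `B`. -/
structure IsFrame (π : ProjRep G H) (Λ : Set G) (g : H) (A B : ℝ) : Prop where
  lower_pos : 0 < A
  upper_pos : 0 < B
  summable : ∀ f : H, Summable (fun l : Λ => ‖π.coeff g f l‖ ^ 2)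
  lower : ∀ f : H, A * ‖f‖ ^ 2 ≤ ∑' l : Λ, ‖π.coeff g f l‖ ^ 2
  upper : ∀ f : H, ∑' l : Λ, ‖π.coeff g f l‖ ^ 2 ≤ B * ‖f‖ ^ 2

end ProjRep

end CoherentFrame

open CoherentFrame

/-! Testing the frame inequality only on the orbit vectors `π(y) g` gives, with `φ = |V_g g|²`, the
covering inequality `A‖g‖² ≤ ∑_λ φ(y⁻¹λ) ≤ B‖g‖²` for every `y`, while the orthogonality relations
give `∫ φ = d⁻¹‖g‖⁴`. Suppose for the moment that `φ` has compact support and integrate over `y ∈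
xK_n`. Each `λ` deep inside `xK_n` contributes `∫ φ`, each `λ` far outside contributes nothing, and
the remaining `λ` lie in a boundary layer. Dividing by `μ(K_n)` yields `A‖g‖² ≤ D⁻ ∫ φ` and `D⁺ ∫ φ
≤ B‖g‖²`, which is the claim after division by `‖g‖²`.

The boundary layer is negligible uniformly in `x` because `Λ` is relatively separated (by the upper
frame bound) and the sequence is strongly Følner (`IsStrongFolner.exists_tendsto_encard_boundary`).
Truncating `φ` to a compact set preserves the upper covering bound. The lower one drops by a tail of
the sum, which the amalgam condition on `g` makes small uniformly in `y`
(`tsum_indicator_compl_le`).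

The same inequalities with `φ` the indicator of a set of a second strong Følner sequence show that
the densities exist and do not depend on the sequence. The formal degree comes from Schur's lemma
applied to `(1 + V_g^* V_g)⁻¹`, constructed from the closed graph of `V_g`; inversion invariance of
the measure then determines how the constant depends on `g`. -/

namespace CoherentFrame

/-! ### Inversion invariance of Haar measure -/

section Unimodular

variable {G : Type*} [Group G] [TopologicalSpace G] [IsTopologicalGroup G]
  [LocallyCompactSpace G] [SecondCountableTopology G] [MeasurableSpace G] [BorelSpace G]

/-- The Haar measure of a second-countable unimodular group is invariant under inversion. -/
theorem isInvInvariant_of_isMulRightInvariant (μ : Measure G) [μ.IsHaarMeasure]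
    [μ.IsMulRightInvariant] : μ.IsInvInvariant := by
  constructor
  -- `μ.inv` is left-invariant because `μ` is right-invariant, so it is a multiple of `μ`. A
  -- symmetric compact set of positive measure shows that the factor is 1.
  have hc := Measure.isMulLeftInvariant_eq_smul μ.inv μ
  set c := Measure.haarScalarFactor μ.inv μ
  obtain ⟨K, hK, hK1⟩ := exists_compact_mem_nhds (1 : G)
  set L := K ∪ K⁻¹
  have hL : IsCompact L := hK.union hK.inv
  have hLinv : L⁻¹ = L := by simp [L, Set.union_comm]
  have hpos : μ L ≠ 0 :=
    (Measure.measure_pos_of_mem_nhds μ (mem_of_superset hK1 Set.subset_union_left)).ne'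
  have h1 : (c : ℝ≥0∞) * μ L = 1 * μ L := by
    have := congrArg (fun ν : Measure G => ν L) hc
    simp only [Measure.inv_apply, hLinv, Measure.smul_apply] at this
    rw [one_mul]
    exact this.symm
  have h2 : c = 1 := by
    exact_mod_cast (ENNReal.mul_left_inj hpos hL.measure_lt_top.ne).1 h1
  rw [hc, h2, one_smul]

end Unimodular

/-! ### From Følner to strong Følner sequences -/

section StrongFolner

variable {G : Type*} [Group G] [TopologicalSpace G] [IsTopologicalGroup G] [T2Space G]
  [LocallyCompactSpace G] [SecondCountableTopology G] [MeasurableSpace G] [BorelSpace G]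
  {μ : Measure G} [μ.IsHaarMeasure]

/-- The boundary of `K * Q` relative to a compact set `C` is controlled by the difference of `K`
and a fixed thickening of `K`. -/
theorem measure_boundary_mul_le {K Q C : Set G} [μ.IsInvInvariant] (hK : IsCompact K)
    (hQ : IsCompact Q) (hQ_symm : Q⁻¹ = Q) (hC : IsCompact C) :
    μ ((K * Q * C) ∩ ((K * Q)ᶜ * C)) * μ Q
      ≤ μ ((K * (Q * C * C⁻¹ * Q)) \ K) * μ (Q * C) := by
  set X := (K * Q * C) ∩ ((K * Q)ᶜ * C)
  set E := (K * (Q * C * C⁻¹ * Q)) \ K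
  have hX : MeasurableSet X := ((hK.mul hQ).mul hC).measurableSet.inter
    ((hK.mul hQ).isClosed.isOpen_compl.mul_right).measurableSet
  have hE : MeasurableSet E :=
    (hK.mul (((hQ.mul hC).mul hC.inv).mul hQ)).measurableSet.diff hK.measurableSet
  have hD : MeasurableSet (C⁻¹ * Q) := (hC.inv.mul hQ).measurableSet
  -- Double counting of pairs `(x, y)`. If `x = kqc = bc'` with `b ∉ KQ`, then `bQ` misses `K` by
  -- symmetry of `Q` and lies in `E ∩ xC⁻¹Q`, so `x` has at least `μ Q` partners. Each `y` has
  -- partners only in `yQC`.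
  set f : G → G → ℝ≥0∞ := fun x y =>
    X.indicator 1 x * (E.indicator 1 y * (C⁻¹ * Q).indicator 1 (x⁻¹ * y))
  have hf : Measurable (Function.uncurry f) := by
    refine ((measurable_one.indicator hX).comp measurable_fst).mul
      (((measurable_one.indicator hE).comp measurable_snd).mul
      ((measurable_one.indicator hD).comp ?_))
    exact (measurable_fst.inv).mul measurable_snd
  have hswap := lintegral_lintegral_swap (μ := μ) (ν := μ) hf.aemeasurable
  calc μ X * μ Q = ∫⁻ x, X.indicator 1 x * μ Q ∂μ := by
        rw [lintegral_mul_const _ (measurable_one.indicator hX), lintegral_indicator_one hX]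
    _ ≤ ∫⁻ x, ∫⁻ y, f x y ∂μ ∂μ := by
        refine lintegral_mono fun x => ?_
        by_cases hx : x ∈ X
        · have : ∀ y, f x y = (E ∩ x • (C⁻¹ * Q)).indicator 1 y := by
            intro y
            have : (x⁻¹ * y ∈ C⁻¹ * Q) ↔ y ∈ x • (C⁻¹ * Q) := by
              rw [Set.mem_smul_set_iff_inv_smul_mem, smul_eq_mul]
            by_cases h1 : y ∈ E <;> by_cases h2 : y ∈ x • (C⁻¹ * Q) <;>
              simp [f, hx, h1, h2, Set.indicator, this]
          simp_rw [this]
          rw [lintegral_indicator_one (hE.inter (hD.const_smul x)), Set.indicator_of_mem hx,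
            Pi.one_apply, one_mul]
          obtain ⟨⟨kq, ⟨k, hk, q, hq, rfl⟩, c, hc, rfl⟩, b, hb, c', hc', hbc⟩ := hx
          dsimp only at hbc ⊢
          rw [← measure_smul μ b Q]
          refine measure_mono ?_
          rintro _ ⟨p, hp, rfl⟩
          have hb' : b = k * q * c * c'⁻¹ := by rw [← hbc]; group
          refine ⟨⟨⟨k, hk, q * c * c'⁻¹ * p, ?_, ?_⟩, ?_⟩, ?_⟩
          · exact Set.mul_mem_mul (Set.mul_mem_mul (Set.mul_mem_mul hq hc)
              (Set.inv_mem_inv.2 hc')) hp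
          · simp [hb', mul_assoc]
          · intro hbp
            refine hb ⟨b * p, hbp, p⁻¹, ?_, by simp⟩
            rw [← hQ_symm]; exact Set.inv_mem_inv.2 hp
          · rw [Set.mem_smul_set_iff_inv_smul_mem]
            refine ⟨c'⁻¹, Set.inv_mem_inv.2 hc', p, hp, ?_⟩
            simp [hb', mul_assoc]
        · simp [hx]
    _ = ∫⁻ y, ∫⁻ x, f x y ∂μ ∂μ := hswap
    _ ≤ ∫⁻ y, E.indicator 1 y * μ (Q * C) ∂μ := by
        refine lintegral_mono fun y => ?_
        by_cases hy : y ∈ E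
        · calc ∫⁻ x, f x y ∂μ ≤ ∫⁻ x, (y • (Q * C)).indicator 1 x ∂μ := by
                refine lintegral_mono fun x => ?_
                by_cases h2 : x⁻¹ * y ∈ C⁻¹ * Q
                · have : x ∈ y • (Q * C) := by
                    rw [Set.mem_smul_set_iff_inv_smul_mem, smul_eq_mul, ← Set.inv_mem_inv,
                      mul_inv_rev, mul_inv_rev, inv_inv, hQ_symm]
                    exact h2
                  by_cases h3 : x ∈ X <;> simp [f, hy, h2, h3, this]
                · simp [f, h2]
            _ = E.indicator 1 y * μ (Q * C) := by
                rw [lintegral_indicator_one ((hQ.mul hC).measurableSet.const_smul y),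
                  measure_smul, Set.indicator_of_mem hy, Pi.one_apply, one_mul]
        · simp [f, hy]
    _ = μ E * μ (Q * C) := by
        rw [lintegral_mul_const _ (measurable_one.indicator hE), lintegral_indicator_one hE]

/-- Thickening a Følner sequence by a compact symmetric neighbourhood of the identity yields a
strong Følner sequence. -/
theorem IsFolner.isStrongFolner_mul {K : ℕ → Set G} [μ.IsInvInvariant] (hK : IsFolner μ K)
    {Q : Set G} (hQ : IsCompact Q) (hQ_nhds : Q ∈ 𝓝 (1 : G)) (hQ_symm : Q⁻¹ = Q) :
    IsStrongFolner μ (fun n => K n * Q) := by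
  have h1Q : (1 : G) ∈ Q := mem_of_mem_nhds hQ_nhds
  have hQne : Q.Nonempty := ⟨1, h1Q⟩
  have hsub : ∀ n, K n ⊆ K n * Q := fun n => Set.subset_mul_left _ h1Q
  have hpos : ∀ n, μ (K n * Q) ≠ 0 := fun n h =>
    hK.measure_ne_zero n (measure_mono_null (hsub n) h)
  refine ⟨⟨fun n => (hK.isCompact n).mul hQ, hpos, ?_⟩, ?_⟩
  · intro C hC hCne
    have h1 := hK.tendsto_symmDiff (Q * C) (hQ.mul hC) (hQne.mul hCne)
    have h2 := hK.tendsto_symmDiff Q hQ ⟨1, h1Q⟩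
    have h3 := h1.add h2
    rw [add_zero] at h3
    refine tendsto_of_tendsto_of_tendsto_of_le_of_le tendsto_const_nhds h3
      (fun n => zero_le) (fun n => ?_)
    dsimp only
    rw [← ENNReal.add_div]
    refine ENNReal.div_le_div ?_ (measure_mono (hsub n))
    rw [mul_assoc]
    refine (measure_mono (symmDiff_triangle _ (K n) _)).trans
      ((measure_union_le _ _).trans_eq ?_)
    rw [symmDiff_comm (K n) (K n * Q)]
  · intro C hC
    rcases C.eq_empty_or_nonempty with rfl | hCne
    · simp
    set T := Q * C * C⁻¹ * Q
    have hT : IsCompact T := ((hQ.mul hC).mul hC.inv).mul hQ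
    have hTne : T.Nonempty := ((hQne.mul hCne).mul hCne.inv).mul hQne
    have hQ0 : μ Q ≠ 0 := (Measure.measure_pos_of_mem_nhds μ hQ_nhds).ne'
    have hQt : μ Q ≠ ∞ := hQ.measure_lt_top.ne
    have hc : μ (Q * C) / μ Q ≠ ∞ := ENNReal.div_ne_top (hQ.mul hC).measure_lt_top.ne hQ0
    have h1 := ENNReal.Tendsto.mul_const (hK.tendsto_symmDiff T hT hTne) (.inr hc)
    rw [zero_mul] at h1
    refine tendsto_of_tendsto_of_tendsto_of_le_of_le tendsto_const_nhds h1
      (fun n => zero_le) (fun n => ?_)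
    dsimp only
    have h2 := measure_boundary_mul_le (μ := μ) (hK.isCompact n) hQ hQ_symm hC
    have h3 : μ (K n * Q * C ∩ ((K n * Q)ᶜ * C))
        ≤ μ (symmDiff (K n * T) (K n)) * (μ (Q * C) / μ Q) := by
      rw [← mul_div_assoc, ENNReal.le_div_iff_mul_le (.inl hQ0) (.inl hQt)]
      refine h2.trans ?_
      gcongr
      exact Set.subset_union_left
    calc _ ≤ μ (symmDiff (K n * T) (K n)) * (μ (Q * C) / μ Q) / μ (K n) :=
          ENNReal.div_le_div h3 (measure_mono (hsub n))
      _ = _ := by simp only [div_eq_mul_inv]; ring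

end StrongFolner

/-! ### Counting points by integrating over translates -/

section Packing

theorem encard_inter_eq_tsum {α : Type*} (Λ S : Set α) :
    ((Λ ∩ S).encard : ℝ≥0∞) = ∑' l : Λ, S.indicator 1 (l : α) := by
  rw [← ENNReal.tsum_set_one, tsum_subtype (Λ ∩ S) (fun _ => (1 : ℝ≥0∞)),
    tsum_subtype Λ (fun l => S.indicator (1 : α → ℝ≥0∞) l)]
  simp_rw [← Set.indicator_indicator]
  rfl

theorem encard_inter_le_add {α : Type*} (Λ : Set α) {S T U : Set α} (h : S ⊆ T ∪ U) :
    ((Λ ∩ S).encard : ℝ≥0∞) ≤ (Λ ∩ T).encard + (Λ ∩ U).encard := by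
  have : (Λ ∩ S).encard ≤ (Λ ∩ T).encard + (Λ ∩ U).encard := by
    refine (Set.encard_le_encard ?_).trans (Set.encard_union_le _ _)
    rw [← Set.inter_union_distrib_left]
    exact Set.inter_subset_inter_right _ h
  exact_mod_cast this

variable {G : Type*} [Group G]

theorem encard_inter_mono {α : Type*} (Λ : Set α) {S T : Set α} (h : S ⊆ T) :
    ((Λ ∩ S).encard : ℝ≥0∞) ≤ (Λ ∩ T).encard := by
  have := Set.encard_le_encard (Set.inter_subset_inter_right Λ h)
  exact_mod_cast this

theorem mem_smul_iff_mem_smul_inv {x l : G} {O : Set G} : l ∈ x • O ↔ x ∈ l • O⁻¹ := by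
  rw [Set.mem_smul_set_iff_inv_smul_mem, Set.mem_smul_set_iff_inv_smul_mem, Set.mem_inv]
  simp

theorem tsum_indicator_inv_mul (Λ C : Set G) (y : G) :
    ∑' l : Λ, C.indicator (1 : G → ℝ≥0∞) (y⁻¹ * l) = (Λ ∩ y • C).encard := by
  rw [encard_inter_eq_tsum]
  refine tsum_congr fun l => ?_
  by_cases h : y⁻¹ * (l : G) ∈ C
  · rw [Set.indicator_of_mem h,
      Set.indicator_of_mem (by rwa [Set.mem_smul_set_iff_inv_smul_mem])]
    rfl
  · rw [Set.indicator_of_notMem h,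
      Set.indicator_of_notMem (by rwa [Set.mem_smul_set_iff_inv_smul_mem])]

variable [TopologicalSpace G] [IsTopologicalGroup G] [MeasurableSpace G] [BorelSpace G]
  {μ : Measure G} {Λ O : Set G} {R : ℝ≥0∞}

/-- Bounded overlap: `x ∈ lO⁻¹` exactly when `l ∈ xO`, so at most `R` of the sets `lO⁻¹` contain a
given `x`. -/
theorem tsum_setLIntegral_smul_le (hΛ : Λ.Countable) (hO : IsOpen O)
    (hR : ∀ x : G, ((Λ ∩ x • O).encard : ℝ≥0∞) ≤ R) {φ : G → ℝ≥0∞} (hφ : AEMeasurable φ μ)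
    (S : Set G) :
    ∑' l : Λ, S.indicator (fun l => ∫⁻ x in l • O⁻¹, φ x ∂μ) (l : G)
      ≤ R * ∫⁻ x in S * O⁻¹, φ x ∂μ := by
  have : Countable Λ := hΛ.to_subtype
  have hm : ∀ l : G, MeasurableSet (l • O⁻¹) := fun l => (hO.inv.smul l).measurableSet
  have hSO : MeasurableSet (S * O⁻¹) := hO.inv.mul_left.measurableSet
  calc _ ≤ ∑' l : Λ, ∫⁻ x in S * O⁻¹, ((l : G) • O⁻¹).indicator φ x ∂μ := by
        refine ENNReal.tsum_le_tsum fun l => ?_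
        by_cases hl : (l : G) ∈ S
        swap
        · rw [Set.indicator_of_notMem hl]
          exact zero_le
        rw [Set.indicator_of_mem hl]
        rw [lintegral_indicator (hm _), Measure.restrict_restrict (hm _),
          Set.inter_eq_self_of_subset_left]
        rintro _ ⟨o, ho, rfl⟩
        exact Set.mul_mem_mul hl ho
    _ = ∫⁻ x in S * O⁻¹, ∑' l : Λ, ((l : G) • O⁻¹).indicator φ x ∂μ :=
        (lintegral_tsum fun l => (hφ.indicator (hm _)).restrict).symm
    _ ≤ ∫⁻ x in S * O⁻¹, R * φ x ∂μ := by
        refine lintegral_mono fun x => ?_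
        calc _ = ∑' l : Λ, (x • O).indicator 1 (l : G) * φ x := by
              refine tsum_congr fun l => ?_
              by_cases h : (l : G) ∈ x • O
              · rw [Set.indicator_of_mem h, Set.indicator_of_mem (mem_smul_iff_mem_smul_inv.1 h)]
                simp
              · rw [Set.indicator_of_notMem h,
                  Set.indicator_of_notMem (fun h' => h (mem_smul_iff_mem_smul_inv.2 h')), zero_mul]
          _ = (Λ ∩ x • O).encard * φ x := by
              rw [ENNReal.tsum_mul_right, encard_inter_eq_tsum]
          _ ≤ R * φ x := by gcongr; exact hR x
    _ = R * ∫⁻ x in S * O⁻¹, φ x ∂μ := lintegral_const_mul'' _ hφ.restrict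

theorem encard_inter_mul_le [μ.IsMulLeftInvariant] (hΛ : Λ.Countable) (hO : IsOpen O)
    (hR : ∀ x : G, ((Λ ∩ x • O).encard : ℝ≥0∞) ≤ R) (S : Set G) (x : G) :
    ((Λ ∩ x • S).encard : ℝ≥0∞) * μ O⁻¹ ≤ R * μ (S * O⁻¹) := by
  have h := tsum_setLIntegral_smul_le (μ := μ) hΛ hO hR (φ := fun _ => 1) aemeasurable_const (x • S)
  rw [setLIntegral_one, smul_mul_assoc, measure_smul] at h
  refine le_trans (le_of_eq ?_) h
  rw [encard_inter_eq_tsum, ← ENNReal.tsum_mul_right]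
  refine tsum_congr fun l => ?_
  by_cases hl : (l : G) ∈ x • S
  · simp [hl, Set.indicator_of_mem, measure_smul]
  · simp [hl, Set.indicator_of_notMem]

variable {φ : G → ℝ≥0∞} {C K : Set G}

theorem lintegral_comp_inv_mul [μ.IsMulLeftInvariant] [μ.IsInvInvariant]
    (φ : G → ℝ≥0∞) (l : G) : ∫⁻ y, φ (y⁻¹ * l) ∂μ = ∫⁻ y, φ y ∂μ := by
  rw [← lintegral_inv_eq_self (μ := μ) φ,
    ← lintegral_mul_left_eq_self (μ := μ) (fun y => φ y⁻¹) l⁻¹]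
  simp

/-- Integrate the covering bound over `y ∈ xK`. For `l ∈ x(K \ KᶜC)` the function `y ↦ φ(y⁻¹l)`
vanishes off `xK`, since otherwise `x⁻¹l = (x⁻¹y)(y⁻¹l) ∈ KᶜC`; such an `l` therefore contributes
the full integral of `φ`. -/
theorem mul_encard_inter_le [T2Space G] [μ.IsMulLeftInvariant] [μ.IsInvInvariant]
    (hΛ : Λ.Countable) (hφ : Measurable φ) (hφC : ∀ x, x ∉ C → φ x = 0) (hK : IsCompact K)
    {b : ℝ≥0∞} (hb : ∀ y : G, ∑' l : Λ, φ (y⁻¹ * l) ≤ b) (x : G) :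
    (∫⁻ y, φ y ∂μ) * ((Λ ∩ x • K).encard : ℝ≥0∞)
      ≤ b * μ K + (∫⁻ y, φ y ∂μ) * ((Λ ∩ x • (K ∩ (Kᶜ * C))).encard : ℝ≥0∞) := by
  have : Countable Λ := hΛ.to_subtype
  have hxK : MeasurableSet (x • K) := hK.measurableSet.const_smul x
  have hsub : x • K ⊆ x • (K \ (Kᶜ * C)) ∪ x • (K ∩ (Kᶜ * C)) := by
    rw [← Set.smul_set_union, Set.sdiff_union_inter]
  refine (mul_le_mul_right (encard_inter_le_add Λ hsub) _).trans ?_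
  rw [mul_add]
  refine add_le_add_left ?_ _
  rw [encard_inter_eq_tsum, ← ENNReal.tsum_mul_left]
  calc _ ≤ ∑' l : Λ, ∫⁻ y in x • K, φ (y⁻¹ * l) ∂μ := by
        refine ENNReal.tsum_le_tsum fun l => ?_
        by_cases hl : (l : G) ∈ x • (K \ (Kᶜ * C))
        · rw [Set.indicator_of_mem hl, Pi.one_apply, mul_one,
            ← lintegral_comp_inv_mul φ (l : G), ← lintegral_indicator hxK]
          refine lintegral_mono fun y => ?_
          by_cases hy : y ∈ x • K
          · rw [Set.indicator_of_mem hy]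
          · rw [Set.indicator_of_notMem hy, hφC]
            intro hyl
            rw [Set.mem_smul_set_iff_inv_smul_mem, smul_eq_mul] at hl hy
            exact hl.2 ⟨x⁻¹ * y, hy, y⁻¹ * l, hyl, by group⟩
        · rw [Set.indicator_of_notMem hl, mul_zero]
          exact zero_le
    _ = ∫⁻ y in x • K, ∑' l : Λ, φ (y⁻¹ * l) ∂μ :=
        (lintegral_tsum fun l : Λ =>
          (hφ.comp (measurable_inv.mul_const (l : G))).aemeasurable).symm
    _ ≤ ∫⁻ y in x • K, b ∂μ := lintegral_mono fun y => hb y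
    _ = b * μ K := by rw [setLIntegral_const, measure_smul]

/-- Dual to `mul_encard_inter_le`: when `y ∈ xK`, only points `l ∈ xKC` contribute, each at most the
integral of `φ`. -/
theorem mul_measure_le_mul_encard [T2Space G] [μ.IsMulLeftInvariant] [μ.IsInvInvariant]
    (hΛ : Λ.Countable) (hφ : Measurable φ) (hφC : ∀ x, x ∉ C → φ x = 0) (hK : IsCompact K)
    {a : ℝ≥0∞} (ha : ∀ y : G, a ≤ ∑' l : Λ, φ (y⁻¹ * l)) (x : G) :
    a * μ K ≤ (∫⁻ y, φ y ∂μ) * ((Λ ∩ x • K).encard : ℝ≥0∞) +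
      (∫⁻ y, φ y ∂μ) * ((Λ ∩ x • (K * C ∩ Kᶜ)).encard : ℝ≥0∞) := by
  have : Countable Λ := hΛ.to_subtype
  have hxK : MeasurableSet (x • K) := hK.measurableSet.const_smul x
  have hsub : x • (K * C) ⊆ x • K ∪ x • (K * C ∩ Kᶜ) := by
    rw [← Set.smul_set_union]
    refine Set.smul_set_mono fun z hz => ?_
    by_cases h : z ∈ K
    · exact .inl h
    · exact .inr ⟨hz, h⟩
  rw [← mul_add]
  refine le_trans ?_ (mul_le_mul_right (encard_inter_le_add Λ hsub) _)
  rw [encard_inter_eq_tsum, ← ENNReal.tsum_mul_left]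
  calc a * μ K = ∫⁻ y in x • K, a ∂μ := by rw [setLIntegral_const, measure_smul]
    _ ≤ ∫⁻ y in x • K, ∑' l : Λ, φ (y⁻¹ * l) ∂μ := lintegral_mono fun y => ha y
    _ = ∑' l : Λ, ∫⁻ y in x • K, φ (y⁻¹ * l) ∂μ :=
        lintegral_tsum fun l => (hφ.comp (measurable_inv.mul_const (l : G))).aemeasurable
    _ ≤ _ := by
        refine ENNReal.tsum_le_tsum fun l => ?_
        by_cases hl : (l : G) ∈ x • (K * C)
        · rw [Set.indicator_of_mem hl, Pi.one_apply, mul_one, ← lintegral_comp_inv_mul φ (l : G)]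
          exact setLIntegral_le_lintegral _ _
        · rw [Set.indicator_of_notMem hl, mul_zero, nonpos_iff_eq_zero]
          refine (setLIntegral_congr_fun hxK fun y hy => ?_).trans lintegral_zero
          refine hφC _ fun hyl => hl ?_
          rw [Set.mem_smul_set_iff_inv_smul_mem, smul_eq_mul] at hy ⊢
          exact ⟨x⁻¹ * y, hy, y⁻¹ * l, hyl, by simp [mul_assoc]⟩

end Packing

theorem HasLowerDensity.le_of_hasUpperDensity {G : Type*} [Group G] [TopologicalSpace G]
    [MeasurableSpace G] {μ : Measure G} {Λ : Set G} {D₁ D₂ : ℝ≥0}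
    (h₁ : HasLowerDensity μ Λ D₁)
    (h₂ : HasUpperDensity μ Λ D₂) : D₁ ≤ D₂ := by
  obtain ⟨K, hK⟩ := h₁.1
  have := le_of_tendsto_of_tendsto' (h₁.2 K hK) (h₂.2 K hK) fun n =>
    (iInf_le _ 1).trans (le_iSup (fun x : G => ((Λ ∩ x • K n).encard : ℝ≥0∞) / μ (K n)) 1)
  exact_mod_cast this

/-! ### Passage to the limit and existence of Beurling densities -/

section Limits

variable {G : Type*} [Group G] [TopologicalSpace G] [IsTopologicalGroup G]
  [LocallyCompactSpace G] [MeasurableSpace G] [BorelSpace G]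
  {μ : Measure G} [μ.IsHaarMeasure] [μ.IsInvInvariant] {Λ : Set G}

/-- The number of points of `Λ` in each translate of a fixed neighbourhood of the identity is
uniformly bounded. -/
def IsRelativelySeparated (Λ : Set G) : Prop :=
  ∃ O : Set G, IsOpen O ∧ (1 : G) ∈ O ∧ ∃ R : ℝ≥0, ∀ x : G, ((Λ ∩ x • O).encard : ℝ≥0∞) ≤ R

/-- The points of a relatively separated set near the boundary of a strong Følner sequence are
negligible. -/
theorem IsStrongFolner.exists_tendsto_encard_boundary (hΛ : Λ.Countable)
    (hsep : IsRelativelySeparated Λ) {K : ℕ → Set G} (hK : IsStrongFolner μ K) {C : Set G}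
    (hC : IsCompact C) :
    ∃ δ : ℕ → ℝ≥0∞, Tendsto δ atTop (𝓝 0) ∧ ∀ (n : ℕ) (x : G),
      ((Λ ∩ x • (K n ∩ ((K n)ᶜ * C))).encard : ℝ≥0∞) ≤ δ n * μ (K n) ∧
      ((Λ ∩ x • (K n * C ∩ (K n)ᶜ)).encard : ℝ≥0∞) ≤ δ n * μ (K n) := by
  obtain ⟨O', hO', h1O', R, hR'⟩ := hsep
  obtain ⟨V, hV, hVO, hVc⟩ := local_compact_nhds (hO'.mem_nhds h1O')
  -- Shrinking to the interior of a compact neighbourhood makes `μ O⁻¹` finite.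
  set O := interior V
  have hO : IsOpen O := isOpen_interior
  have h1O : (1 : G) ∈ O := mem_interior_iff_mem_nhds.2 hV
  have hR : ∀ x : G, ((Λ ∩ x • O).encard : ℝ≥0∞) ≤ R := fun x =>
    (encard_inter_mono Λ (Set.smul_set_mono (interior_subset.trans hVO))).trans (hR' x)
  -- `D` contains both `O⁻¹` and `CO⁻¹`, so thickening either boundary layer by `O⁻¹` stays inside
  -- the boundary of `K n` relative to `D`.
  set D := insert 1 C * V⁻¹
  have hD : IsCompact D := (hC.insert 1).mul hVc.inv
  have hO0 : μ O⁻¹ ≠ 0 := by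
    rw [Measure.measure_inv]; exact (hO.measure_pos μ ⟨1, h1O⟩).ne'
  have hOt : μ O⁻¹ ≠ ∞ := by
    rw [Measure.measure_inv]
    exact ((measure_mono interior_subset).trans_lt hVc.measure_lt_top).ne
  have hOV : O⁻¹ ⊆ V⁻¹ := Set.inv_subset_inv.2 interior_subset
  have h1 : O⁻¹ ⊆ D := fun z hz => ⟨1, Set.mem_insert _ _, z, hOV hz, one_mul z⟩
  have h2 : C * O⁻¹ ⊆ D := Set.mul_subset_mul (Set.subset_insert _ _) hOV
  have key : ∀ (n : ℕ) (S : Set G) (x : G), S * O⁻¹ ⊆ (K n * D) ∩ ((K n)ᶜ * D) →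
      ((Λ ∩ x • S).encard : ℝ≥0∞) ≤
        R / μ O⁻¹ * (μ ((K n * D) ∩ ((K n)ᶜ * D)) / μ (K n)) * μ (K n) := by
    intro n S x hS
    rw [mul_assoc, ENNReal.div_mul_cancel (hK.measure_ne_zero n)
      (hK.isCompact n).measure_lt_top.ne, ← ENNReal.mul_div_right_comm,
      ENNReal.le_div_iff_mul_le (.inl hO0) (.inl hOt)]
    exact (encard_inter_mul_le hΛ hO hR S x).trans (mul_le_mul_right (measure_mono hS) _)
  refine ⟨fun n => R / μ O⁻¹ * (μ ((K n * D) ∩ ((K n)ᶜ * D)) / μ (K n)), ?_,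
    fun n x => ⟨key n _ x ?_, key n _ x ?_⟩⟩
  · have := ENNReal.Tendsto.const_mul (a := (R : ℝ≥0∞) / μ O⁻¹) (hK.tendsto_boundary D hD)
      (.inr (ENNReal.div_ne_top ENNReal.coe_ne_top hO0))
    rwa [mul_zero] at this
  · refine Set.subset_inter (Set.mul_subset_mul Set.inter_subset_left h1) ?_
    refine (Set.mul_subset_mul_right Set.inter_subset_right).trans ?_
    rw [mul_assoc]
    exact Set.mul_subset_mul_left h2
  · refine Set.subset_inter ?_ (Set.mul_subset_mul Set.inter_subset_right h1)
    refine (Set.mul_subset_mul_right Set.inter_subset_left).trans ?_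
    rw [mul_assoc]
    exact Set.mul_subset_mul_left h2

variable [T2Space G] {φ : G → ℝ≥0∞} {C : Set G} {K : ℕ → Set G}

/-- The boundary term in `mul_encard_inter_le` is at most `δ n * μ (K n)` times the integral,
uniformly in `x`, and so disappears in the limit. -/
theorem IsStrongFolner.limsup_iSup_le (hK : IsStrongFolner μ K) (hΛ : Λ.Countable)
    (hsep : IsRelativelySeparated Λ) (hC : IsCompact C) (hφ : Measurable φ)
    (hφC : ∀ x, x ∉ C → φ x = 0) (h0 : ∫⁻ y, φ y ∂μ ≠ 0) (ht : ∫⁻ y, φ y ∂μ ≠ ∞)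
    {b : ℝ≥0∞} (hb : ∀ y : G, ∑' l : Λ, φ (y⁻¹ * l) ≤ b) :
    limsup (fun n => ⨆ x : G, ((Λ ∩ x • K n).encard : ℝ≥0∞) / μ (K n)) atTop
      ≤ b / ∫⁻ y, φ y ∂μ := by
  obtain ⟨δ, hδ, hbd⟩ := hK.exists_tendsto_encard_boundary hΛ hsep hC
  have hlim : limsup (fun n => b / (∫⁻ y, φ y ∂μ) + δ n) atTop = b / ∫⁻ y, φ y ∂μ := by
    exact (ENNReal.limsup_add_of_right_tendsto_zero hδ (fun _ => b / ∫⁻ y, φ y ∂μ)).trans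
      (limsup_const _)
  rw [← hlim]
  refine limsup_le_limsup (Eventually.of_forall fun n => iSup_le fun x => ?_)
  have hμ0 := hK.measure_ne_zero n
  have hμt := (hK.isCompact n).measure_lt_top (μ := μ).ne
  rw [ENNReal.div_le_iff hμ0 hμt, add_mul]
  have h := mul_encard_inter_le (μ := μ) hΛ hφ hφC (hK.isCompact n) hb x
  have h2 := h.trans (add_le_add_right (mul_le_mul_right (hbd n x).1 _) _)
  rw [mul_comm, ← ENNReal.le_div_iff_mul_le (.inl h0) (.inl ht)] at h2
  refine h2.trans_eq ?_
  rw [ENNReal.add_div, mul_comm (∫⁻ y, φ y ∂μ), ENNReal.mul_div_cancel_right h0 ht,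
    ENNReal.mul_div_right_comm]

theorem IsStrongFolner.le_liminf_iInf (hK : IsStrongFolner μ K) (hΛ : Λ.Countable)
    (hsep : IsRelativelySeparated Λ) (hC : IsCompact C) (hφ : Measurable φ)
    (hφC : ∀ x, x ∉ C → φ x = 0) {a : ℝ≥0∞} (ha : ∀ y : G, a ≤ ∑' l : Λ, φ (y⁻¹ * l)) :
    a / ∫⁻ y, φ y ∂μ ≤
      liminf (fun n => ⨅ x : G, ((Λ ∩ x • K n).encard : ℝ≥0∞) / μ (K n)) atTop := by
  obtain ⟨δ, hδ, hbd⟩ := hK.exists_tendsto_encard_boundary hΛ hsep hC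
  rw [← ENNReal.liminf_add_of_right_tendsto_zero hδ]
  refine le_liminf_of_le (by isBoundedDefault) (Eventually.of_forall fun n => ?_)
  rw [Pi.add_apply, ENNReal.iInf_add]
  refine le_iInf fun x => ?_
  have hμ0 := hK.measure_ne_zero n
  have hμt := (hK.isCompact n).measure_lt_top (μ := μ).ne
  have h := mul_measure_le_mul_encard (μ := μ) hΛ hφ hφC (hK.isCompact n) ha x
  have h2 := h.trans (add_le_add_right (mul_le_mul_right (hbd n x).2 _) _)
  rw [← mul_add, ← ENNReal.le_div_iff_mul_le (.inl hμ0) (.inl hμt)] at h2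
  refine ENNReal.div_le_of_le_mul ?_
  refine h2.trans_eq ?_
  rw [mul_div_assoc, ENNReal.add_div, ENNReal.mul_div_cancel_right hμ0 hμt, mul_comm]

/-- The upper Beurling density of a countable relatively separated set exists. -/
theorem exists_hasUpperDensity (hΛ : Λ.Countable) (hsep : IsRelativelySeparated Λ)
    (hex : ∃ K : ℕ → Set G, IsStrongFolner μ K) : ∃ D : ℝ≥0, HasUpperDensity μ Λ D := by
  set s : (ℕ → Set G) → ℕ → ℝ≥0∞ := fun K n => ⨆ x : G, ((Λ ∩ x • K n).encard : ℝ≥0∞) / μ (K n)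
  have h1 : ∀ K L : ℕ → Set G, IsStrongFolner μ K → IsStrongFolner μ L →
      limsup (s K) atTop ≤ liminf (s L) atTop := by
    intro K L hK hL
    refine le_liminf_of_le (by isBoundedDefault) (Eventually.of_forall fun m => ?_)
    have hm := (hL.isCompact m).measurableSet
    have hI : ∫⁻ y, (L m).indicator 1 y ∂μ = μ (L m) := lintegral_indicator_one hm
    -- For this `φ` the covering sum is `#(Λ ∩ y L_m)`, so the best `b` divided by the integral is
    -- the `m`-th term of the sequence for `L`.
    have h := hK.limsup_iSup_le hΛ hsep (hL.isCompact m) (φ := (L m).indicator 1)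
      (measurable_one.indicator hm) (fun x hx => Set.indicator_of_notMem hx _)
      (by rw [hI]; exact hL.measure_ne_zero m)
      (by rw [hI]; exact (hL.isCompact m).measure_lt_top.ne)
      (b := ⨆ x : G, ((Λ ∩ x • L m).encard : ℝ≥0∞))
      (fun y => by rw [tsum_indicator_inv_mul]; exact le_iSup_of_le y le_rfl)
    rw [hI, ENNReal.iSup_div] at h
    exact h
  obtain ⟨K₀, hK₀⟩ := hex
  have hfin : limsup (s K₀) atTop ≠ ∞ := by
    have ⟨O, hO, h1O, R, hR⟩ := hsep
    obtain ⟨V, hV, hVO, hVc⟩ := local_compact_nhds (hO.mem_nhds h1O)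
    have hm := hVc.measurableSet
    have hI : ∫⁻ y, V.indicator 1 y ∂μ = μ V := lintegral_indicator_one hm
    have hV0 : μ V ≠ 0 := (Measure.measure_pos_of_mem_nhds μ hV).ne'
    refine ((hK₀.limsup_iSup_le hΛ hsep hVc (φ := V.indicator 1)
      (measurable_one.indicator hm) (fun x hx => Set.indicator_of_notMem hx _)
      (by rwa [hI]) (by rw [hI]; exact hVc.measure_lt_top.ne) (b := R)
      (fun y => ?_)).trans_lt ?_).ne
    · rw [tsum_indicator_inv_mul]
      exact (encard_inter_mono Λ (Set.smul_set_mono hVO)).trans (hR y)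
    · rw [hI]
      exact ENNReal.div_lt_top ENNReal.coe_ne_top hV0
  refine ⟨(limsup (s K₀) atTop).toNNReal, ⟨K₀, hK₀⟩, fun K hK => ?_⟩
  rw [ENNReal.coe_toNNReal hfin]
  refine tendsto_of_le_liminf_of_limsup_le (h1 K₀ K hK₀ hK) ?_
  exact (h1 K K₀ hK hK₀).trans (liminf_le_limsup)

/-- The lower Beurling density of a countable relatively separated set exists. -/
theorem exists_hasLowerDensity (hΛ : Λ.Countable) (hsep : IsRelativelySeparated Λ)
    (hex : ∃ K : ℕ → Set G, IsStrongFolner μ K) : ∃ D : ℝ≥0, HasLowerDensity μ Λ D := by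
  set s : (ℕ → Set G) → ℕ → ℝ≥0∞ := fun K n => ⨅ x : G, ((Λ ∩ x • K n).encard : ℝ≥0∞) / μ (K n)
  have h1 : ∀ K L : ℕ → Set G, IsStrongFolner μ K → IsStrongFolner μ L →
      limsup (s L) atTop ≤ liminf (s K) atTop := by
    intro K L hK hL
    refine limsup_le_of_le (by isBoundedDefault) (Eventually.of_forall fun m => ?_)
    have hm := (hL.isCompact m).measurableSet
    have hI : ∫⁻ y, (L m).indicator 1 y ∂μ = μ (L m) := lintegral_indicator_one hm
    have hμ0 := hL.measure_ne_zero m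
    have hμt := (hL.isCompact m).measure_lt_top (μ := μ).ne
    have h := hK.le_liminf_iInf hΛ hsep (hL.isCompact m) (φ := (L m).indicator 1)
      (measurable_one.indicator hm) (fun x hx => Set.indicator_of_notMem hx _)
      (a := ⨅ x : G, ((Λ ∩ x • L m).encard : ℝ≥0∞))
      (fun y => by rw [tsum_indicator_inv_mul]; exact iInf_le_of_le y le_rfl)
    rw [hI, ENNReal.iInf_div_of_ne hμ0 hμt] at h
    exact h
  obtain ⟨K₀, hK₀⟩ := hex
  obtain ⟨D, hD⟩ := exists_hasUpperDensity hΛ hsep ⟨K₀, hK₀⟩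
  have hfin : limsup (s K₀) atTop ≠ ∞ := by
    refine ((limsup_le_limsup (Eventually.of_forall fun n => ?_)).trans_lt
      ((hD.2 K₀ hK₀).limsup_eq.trans_lt ENNReal.coe_lt_top)).ne
    exact (iInf_le _ 1).trans (le_iSup (fun x : G => ((Λ ∩ x • K₀ n).encard : ℝ≥0∞) / μ (K₀ n)) 1)
  refine ⟨(limsup (s K₀) atTop).toNNReal, ⟨K₀, hK₀⟩, fun K hK => ?_⟩
  rw [ENNReal.coe_toNNReal hfin]
  refine tendsto_of_le_liminf_of_limsup_le (h1 K K₀ hK hK₀) ?_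
  exact (h1 K₀ K hK₀ hK).trans (liminf_le_limsup)

end Limits

/-! ### Projective representations: phases and coefficients -/

namespace ProjRep

open scoped ComplexConjugate InnerProductSpace

section Basic

variable {G H : Type*} [Group G] [MeasurableSpace G]
  [NormedAddCommGroup H] [InnerProductSpace ℂ H] (π : ProjRep G H)

theorem op_one (f : H) : (π.σ 1 1 : ℂ) • π.op 1 f = f := by
  have h := π.map_mul 1 1 f
  rw [mul_one] at h
  apply (π.op 1).injective
  rw [map_smul]
  exact h.symm

theorem op_symm (x : G) (f : H) : (π.op x).symm f = (π.σ 1 1 * π.σ x x⁻¹ : ℂ) • π.op x⁻¹ f := by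
  apply (π.op x).injective
  rw [LinearIsometryEquiv.apply_symm_apply, map_smul, mul_smul, ← π.map_mul, mul_inv_cancel,
    π.op_one]

theorem norm_coeff_mul (g f : H) (x y : G) :
    ‖π.coeff g f (x * y)‖ = ‖π.coeff g ((π.op x).symm f) y‖ := by
  rw [coeff, coeff, π.map_mul, inner_smul_left, norm_mul, RCLike.norm_conj, Circle.norm_coe,
    one_mul, LinearIsometryEquiv.inner_map_eq_flip]

theorem norm_coeff_op (g f : H) (x y : G) :
    ‖π.coeff g (π.op x f) y‖ = ‖π.coeff g f (x⁻¹ * y)‖ := by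
  have h := π.norm_coeff_mul g (π.op x f) x (x⁻¹ * y)
  rwa [mul_inv_cancel_left, LinearIsometryEquiv.symm_apply_apply] at h

theorem norm_coeff_one (g f : H) : ‖π.coeff g f 1‖ = ‖inner ℂ g f‖ := by
  conv_rhs => rw [← π.op_one g]
  rw [coeff, inner_smul_left, norm_mul, RCLike.norm_conj, Circle.norm_coe, one_mul]

theorem stronglyMeasurable_coeff (g f : H) : StronglyMeasurable (π.coeff g f) :=
  (π.stronglyMeasurable g).inner stronglyMeasurable_const

theorem coeff_add_right (g f₁ f₂ : H) : π.coeff g (f₁ + f₂) = π.coeff g f₁ + π.coeff g f₂ := by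
  ext x; simp [coeff]

theorem coeff_smul_right (g f : H) (c : ℂ) : π.coeff g (c • f) = c • π.coeff g f := by
  ext x; simp [coeff]

theorem coeff_zero_right (g : H) : π.coeff g 0 = 0 := by
  ext x; simp [coeff]

/-- Left translation multiplies all coefficients by a common phase. -/
theorem coeff_op (g f : H) (x y : G) :
    π.coeff g (π.op x f) y = conj (π.σ x (x⁻¹ * y) : ℂ) * π.coeff g f (x⁻¹ * y) := by
  have h := π.map_mul x (x⁻¹ * y) g
  rw [mul_inv_cancel_left] at h
  rw [coeff, h, inner_smul_left, LinearIsometryEquiv.inner_map_map, coeff]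

/-- Inversion exchanges the two vectors of a coefficient, up to a common phase. -/
theorem coeff_inv (g f : H) (x : G) :
    π.coeff g f x⁻¹ = (π.σ 1 1 * π.σ x x⁻¹ : ℂ) * conj (π.coeff f g x) := by
  have h : π.op x⁻¹ g = (((π.σ 1 1 * π.σ x x⁻¹)⁻¹ : Circle) : ℂ) • (π.op x).symm g := by
    rw [op_symm, ← Circle.coe_mul, smul_smul, ← Circle.coe_mul, inv_mul_cancel, Circle.coe_one,
      one_smul]
  rw [coeff, h, inner_smul_left, Circle.coe_inv_eq_conj, RCLike.conj_conj, Circle.coe_mul, coeff,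
    inner_conj_symm]
  exact congrArg _ ((π.op x).symm.inner_map_eq_flip g f)

end Basic

/-! ### Automatic continuity up to phases -/

section Continuity

variable {G H : Type*} [Group G] [TopologicalSpace G] [IsTopologicalGroup G]
  [LocallyCompactSpace G] [SecondCountableTopology G] [MeasurableSpace G] [BorelSpace G]
  [NormedAddCommGroup H] [InnerProductSpace ℂ H] (π : ProjRep G H)

/-- A strongly measurable projective representation is continuous at the identity up to phases. -/
theorem eventually_exists_norm_smul_op_sub_lt (g : H) {ε : ℝ} (hε : 0 < ε) :
    ∀ᶠ z in 𝓝 (1 : G), ∃ c : Circle, ‖(c : ℂ) • π.op z g - g‖ < ε := by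
  let μ : Measure G := Measure.haar
  obtain ⟨t, ht, htd⟩ := (π.stronglyMeasurable g).isSeparable_range
  have hcov : ⋃ h ∈ t, {x : G | ‖π.op x g - h‖ < ε / 2} = Set.univ := by
    refine Set.eq_univ_of_forall fun x => ?_
    obtain ⟨h, hh, hd⟩ := Metric.mem_closure_iff.1 (htd (Set.mem_range_self x)) (ε / 2) (half_pos hε)
    rw [dist_eq_norm] at hd
    exact Set.mem_biUnion hh hd
  obtain ⟨h, hE⟩ : ∃ h : H, μ {x : G | ‖π.op x g - h‖ < ε / 2} ≠ 0 := by
    by_contra! hall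
    have := (measure_biUnion_null_iff ht).2 fun h _ => hall h
    rw [hcov] at this
    exact (NeZero.ne (μ Set.univ)) this
  set E := {x : G | ‖π.op x g - h‖ < ε / 2}
  have hEm : MeasurableSet E :=
    measurableSet_lt ((π.stronglyMeasurable g).sub stronglyMeasurable_const).norm.measurable
      measurable_const
  have hE' : 0 < μ E⁻¹ := pos_iff_ne_zero.2 fun h => hE ((measure_inv_null μ).1 h)
  -- Steinhaus' theorem is applied to `E⁻¹` because quotients `x⁻¹y` with `x, y ∈ E` are needed: up
  -- to a phase, `π(x⁻¹y)g - g` has the norm of `π(y)g - π(x)g`.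
  filter_upwards [Measure.div_mem_nhds_one_of_haar_pos μ E⁻¹ hEm.inv hE']
  rintro _ ⟨a, ha, b, hb, rfl⟩
  dsimp only
  rw [div_eq_mul_inv]
  set x := a⁻¹
  have hx : ‖π.op x g - h‖ < ε / 2 := ha
  have hy : ‖π.op b⁻¹ g - h‖ < ε / 2 := hb
  have hab : a * b⁻¹ = x⁻¹ * b⁻¹ := by simp [x]
  rw [hab]
  refine ⟨π.σ x (x⁻¹ * b⁻¹), ?_⟩
  have h1 := π.map_mul x (x⁻¹ * b⁻¹) g
  rw [mul_inv_cancel_left] at h1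
  rw [← (π.op x).norm_map, map_sub, map_smul, ← h1]
  calc ‖π.op b⁻¹ g - π.op x g‖ = ‖(π.op b⁻¹ g - h) - (π.op x g - h)‖ := by congr 1; abel
    _ ≤ ‖π.op b⁻¹ g - h‖ + ‖π.op x g - h‖ := norm_sub_le _ _
    _ < ε := by linarith

/-- Only the modulus is claimed to be continuous, since the phases are arbitrary. Moving `x` onto
`f` by an isometry reduces continuity at `x` to continuity at the identity up to phases. -/
theorem continuous_norm_coeff (g f : H) : Continuous fun x => ‖π.coeff g f x‖ := by
  refine continuous_iff_continuousAt.2 fun x => ?_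
  rw [ContinuousAt, Metric.tendsto_nhds]
  intro ε hε
  have hδ : 0 < ε / (‖f‖ + 1) := by positivity
  have h1 := π.eventually_exists_norm_smul_op_sub_lt g hδ
  have hlim : Tendsto (fun y => x⁻¹ * y) (𝓝 x) (𝓝 1) := by
    have := (continuous_const_mul x⁻¹).tendsto x
    rwa [inv_mul_cancel] at this
  filter_upwards [hlim.eventually h1] with y hy
  obtain ⟨c, hc⟩ := hy
  set z := x⁻¹ * y
  have hyz : y = x * z := by simp [z]
  rw [hyz, π.norm_coeff_mul]
  set f' := (π.op x).symm f
  have hf' : ‖f'‖ = ‖f‖ := (π.op x).symm.norm_map f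
  have e1 : ‖π.coeff g f x‖ = ‖inner ℂ g f'‖ := by
    rw [coeff, LinearIsometryEquiv.inner_map_eq_flip]
  have e2 : ‖π.coeff g f' z‖ = ‖inner ℂ ((c : ℂ) • π.op z g) f'‖ := by
    rw [inner_smul_left, norm_mul, RCLike.norm_conj, Circle.norm_coe, one_mul, coeff]
  rw [e1, e2, Real.dist_eq]
  refine (abs_norm_sub_norm_le _ _).trans_lt ?_
  rw [← inner_sub_left]
  calc _ ≤ ‖(c : ℂ) • π.op z g - g‖ * ‖f'‖ := norm_inner_le_norm _ _
    _ ≤ ε / (‖f‖ + 1) * ‖f‖ := by rw [hf']; gcongr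
    _ < ε := by
      rw [div_mul_eq_mul_div, div_lt_iff₀ (by positivity)]
      nlinarith [norm_nonneg f]

end Continuity

/-! ### Schur's lemma -/

section Schur

variable {G H : Type*} [Group G] [MeasurableSpace G]
  [NormedAddCommGroup H] [InnerProductSpace ℂ H] [CompleteSpace H] {π : ProjRep G H}

/-- **Schur's lemma** for self-adjoint operators. -/
theorem IsIrreducible.exists_eq_smul_of_isSelfAdjoint [Nontrivial H] (hπ : π.IsIrreducible)
    {T : H →L[ℂ] H} (hT : IsSelfAdjoint T) (hcomm : ∀ x f, T (π.op x f) = π.op x (T f)) :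
    ∃ c : ℝ, ∀ f, T f = (c : ℂ) • f := by
  -- The kernel of `cfc φ T` is closed and invariant, so the operator is zero or injective. Two
  -- spectral points would give tent functions with product zero and nonzero operators, a
  -- contradiction.
  have hker : ∀ φ : ℝ → ℝ, cfc φ T = 0 ∨ ∀ S : H →L[ℂ] H, cfc φ T * S = 0 → S = 0 := by
    intro φ
    have hc : ∀ x f, cfc φ T (π.op x f) = π.op x (cfc φ T f) := by
      intro x f
      have h1 : Commute T (π.op x).toContinuousLinearEquiv.toContinuousLinearMap := by
        ext f; exact hcomm x f
      exact congrArg (fun S : H →L[ℂ] H => S f) (h1.cfc_real φ).eq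
    rcases hπ (cfc φ T).ker (cfc φ T).isClosed_ker (fun x f hf => by
      rw [LinearMap.mem_ker] at hf ⊢
      exact (hc x f).trans ((congrArg (π.op x) hf).trans (map_zero _))) with h | h
    · right
      intro S hS
      ext f
      have : S f ∈ (cfc φ T).ker := congrArg (fun S : H →L[ℂ] H => S f) hS
      rw [h] at this
      exact this
    · left
      ext f
      have : f ∈ (cfc φ T).ker := by rw [h]; trivial
      exact this
  obtain ⟨a, ha⟩ : (spectrum ℝ T).Nonempty :=
    ContinuousFunctionalCalculus.spectrum_nonempty T hT
  have hspec : ∀ b ∈ spectrum ℝ T, b = a := by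
    intro b hb
    by_contra hab
    set r := |b - a| / 2
    have hr : 0 < r := half_pos (abs_pos.2 (sub_ne_zero.2 hab))
    set φ : ℝ → ℝ → ℝ := fun c t => max 0 (r - |t - c|)
    have hcont : ∀ c, Continuous (φ c) := fun c => by fun_prop
    have hne : ∀ c ∈ spectrum ℝ T, cfc (φ c) T ≠ 0 := by
      intro c hc h0
      rw [← cfc_zero ℝ T] at h0
      have h1 := (cfc_eq_cfc_iff_eqOn (R := ℝ) (a := T)).1 h0 hc
      simp [φ] at h1
      linarith
    refine (hker (φ a)).elim (hne a ha) fun h => hne b hb (h _ ?_)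
    rw [← cfc_mul (φ a) (φ b) T (hcont a).continuousOn (hcont b).continuousOn]
    rw [← cfc_zero ℝ T]
    refine cfc_congr fun t _ => ?_
    have h1 : |b - a| ≤ |t - a| + |t - b| := by
      rw [abs_sub_comm t b, add_comm]; exact abs_sub_le b t a
    rcases le_total r |t - a| with h2 | h2
    · simp [φ, h2]
    · have h3 : r ≤ |t - b| := by simp only [r] at h2 ⊢; linarith
      simp [φ, h3]
  refine ⟨a, fun f => ?_⟩
  have hT' : T = algebraMap ℝ (H →L[ℂ] H) a := by
    conv_lhs => rw [← cfc_id ℝ T]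
    rw [← cfc_const a T]
    exact cfc_congr fun b hb => hspec b hb
  rw [hT', Algebra.algebraMap_eq_smul_one]
  rfl

end Schur

/-! ### The coefficient transform as a closed operator -/

section Gram

variable {G H : Type*} [Group G] [MeasurableSpace G]
  [NormedAddCommGroup H] [InnerProductSpace ℂ H] (π : ProjRep G H) (μ : Measure G)

/-- The graph of the coefficient transform `f ↦ V_g f`, regarded as an operator into `L²`. -/
noncomputable def coeffGraph (g : H) : Submodule ℂ (WithLp 2 (H × Lp ℂ 2 μ)) where
  carrier := {p | p.snd =ᵐ[μ] π.coeff g p.fst}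
  add_mem' {p q} hp hq := by
    change (p.snd + q.snd : Lp ℂ 2 μ) =ᵐ[μ] π.coeff g (p.fst + q.fst)
    rw [coeff_add_right]
    have hp' : p.snd =ᵐ[μ] π.coeff g p.fst := hp
    have hq' : q.snd =ᵐ[μ] π.coeff g q.fst := hq
    exact (Lp.coeFn_add _ _).trans (hp'.add hq')
  zero_mem' := by
    change (0 : Lp ℂ 2 μ) =ᵐ[μ] π.coeff g 0
    rw [coeff_zero_right]
    exact Lp.coeFn_zero _ _ _
  smul_mem' c p hp := by
    change (c • p.snd : Lp ℂ 2 μ) =ᵐ[μ] π.coeff g (c • p.fst)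
    rw [coeff_smul_right]
    have hp' : p.snd =ᵐ[μ] π.coeff g p.fst := hp
    exact (Lp.coeFn_smul _ _).trans (hp'.const_smul c)

variable {π μ}

theorem mem_coeffGraph {g : H} {p : WithLp 2 (H × Lp ℂ 2 μ)} :
    p ∈ π.coeffGraph μ g ↔ p.snd =ᵐ[μ] π.coeff g p.fst := Iff.rfl

/-- `L²` convergence gives almost everywhere convergence along a subsequence, and each evaluation `f
↦ V_g f(x)` is continuous on `H`. -/
theorem isClosed_coeffGraph (g : H) : IsClosed (π.coeffGraph μ g : Set (WithLp 2 (H × Lp ℂ 2 μ))) := by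
  refine IsSeqClosed.isClosed fun u p hu hp => ?_
  have h1 : Tendsto (fun n => (u n).fst) atTop (𝓝 p.fst) :=
    ((WithLp.fstL 2 ℂ H (Lp ℂ 2 μ)).continuous.tendsto p).comp hp
  have h2 : Tendsto (fun n => (u n).snd) atTop (𝓝 p.snd) :=
    ((WithLp.sndL 2 ℂ H (Lp ℂ 2 μ)).continuous.tendsto p).comp hp
  obtain ⟨ns, hns, hae⟩ := (tendstoInMeasure_of_tendsto_Lp h2).exists_seq_tendsto_ae
  have hall : ∀ᵐ x ∂μ, ∀ n, (u n).snd x = π.coeff g (u n).fst x := ae_all_iff.2 fun n => hu n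
  refine mem_coeffGraph.2 ?_
  filter_upwards [hae, hall] with x hx hx'
  refine tendsto_nhds_unique hx ?_
  simp_rw [hx']
  have : Continuous fun f : H => π.coeff g f x := continuous_const.inner continuous_id
  exact (this.tendsto _).comp (h1.comp hns.tendsto_atTop)

theorem toLp_mem_coeffGraph {g f : H} (hf : MemLp (π.coeff g f) 2 μ) :
    WithLp.toLp 2 (f, hf.toLp _) ∈ π.coeffGraph μ g := hf.coeFn_toLp

theorem memLp_of_mem_coeffGraph {g : H} {p : WithLp 2 (H × Lp ℂ 2 μ)}
    (hp : p ∈ π.coeffGraph μ g) : MemLp (π.coeff g p.fst) 2 μ :=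
  (memLp_congr_ae (mem_coeffGraph.1 hp)).1 (Lp.memLp _)

variable (π μ) in
/-- `u` is the solution of the variational problem
`⟨v, u⟩ + ⟨V_g v, V_g u⟩ = ⟨v, h⟩` for all `v` in the domain of `V_g`. -/
def IsGramSolution (g u h : H) : Prop :=
  MemLp (π.coeff g u) 2 μ ∧ ∀ v, MemLp (π.coeff g v) 2 μ →
    ⟪v, u⟫_ℂ + ∫ x, ⟪π.coeff g v x, π.coeff g u x⟫_ℂ ∂μ = ⟪v, h⟫_ℂ

/-- Testing the difference of the two identities on `w = u - u'` gives `‖w‖² + ‖V_g w‖² = 0`. -/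
theorem IsGramSolution.unique {g u u' h : H} (hu : π.IsGramSolution μ g u h)
    (hu' : π.IsGramSolution μ g u' h) : u = u' := by
  have hd : MemLp (π.coeff g (u - u')) 2 μ := by
    have := hu.1.sub hu'.1
    rwa [sub_eq_add_neg, ← neg_one_smul ℂ u', coeff_add_right, coeff_smul_right, neg_one_smul,
      ← sub_eq_add_neg]
  have h := (hu.2 _ hd).trans (hu'.2 _ hd).symm
  have key : ⟪u - u', u - u'⟫_ℂ +
      ∫ x, ⟪π.coeff g (u - u') x, π.coeff g (u - u') x⟫_ℂ ∂μ = 0 := by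
    have hint : ∀ w, MemLp (π.coeff g w) 2 μ →
        Integrable (fun x => ⟪π.coeff g (u - u') x, π.coeff g w x⟫_ℂ) μ := fun w hw =>
      (L2.integrable_inner (𝕜 := ℂ) (hd.toLp _) (hw.toLp _)).congr (by
        filter_upwards [hd.coeFn_toLp, hw.coeFn_toLp] with x h1 h2
        rw [h1, h2])
    have e : ∀ x, ⟪π.coeff g (u - u') x, π.coeff g (u - u') x⟫_ℂ =
        ⟪π.coeff g (u - u') x, π.coeff g u x⟫_ℂ - ⟪π.coeff g (u - u') x, π.coeff g u' x⟫_ℂ := by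
      intro x
      rw [← inner_sub_right]
      congr 1
      simp [coeff]
    simp_rw [e]
    rw [integral_sub (hint _ hu.1) (hint _ hu'.1), inner_sub_right]
    linear_combination h
  have hnn : 0 ≤ (∫ x, ⟪π.coeff g (u - u') x, π.coeff g (u - u') x⟫_ℂ ∂μ).re := by
    simp_rw [inner_self_eq_norm_sq_to_K]
    norm_cast
    exact integral_nonneg fun x => by positivity
  have hre := congrArg Complex.re key
  rw [Complex.add_re, Complex.zero_re, inner_self_eq_norm_sq_to_K] at hre
  have h0 : ((‖u - u'‖ : ℂ) ^ 2).re = ‖u - u'‖ ^ 2 := by norm_cast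
  have : ‖u - u'‖ ^ 2 = 0 := by
    have := sq_nonneg ‖u - u'‖
    change ((‖u - u'‖ : ℂ) ^ 2).re + _ = _ at hre
    linarith
  exact sub_eq_zero.1 (norm_eq_zero.1 (pow_eq_zero_iff two_ne_zero |>.1 this))

/-- With `j` the projection of the graph to `H`, the operator is `j j*`, formally `(1 + V_g^*
V_g)⁻¹`. The adjoint identity for `j` is the variational problem, so `V_g` need not be bounded or
densely defined. -/
theorem exists_isGramSolution [CompleteSpace H] (g : H) :
    ∃ T : H →L[ℂ] H, IsSelfAdjoint T ∧ ∀ h, π.IsGramSolution μ g (T h) h := by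
  have : CompleteSpace (π.coeffGraph μ g) := (isClosed_coeffGraph g).completeSpace_coe
  let j : π.coeffGraph μ g →L[ℂ] H :=
    (WithLp.fstL 2 ℂ H (Lp ℂ 2 μ)) ∘L (π.coeffGraph μ g).subtypeL
  refine ⟨j ∘L ContinuousLinearMap.adjoint j,
    (ContinuousLinearMap.isPositive_self_comp_adjoint j).isSelfAdjoint, fun h => ?_⟩
  set p := ContinuousLinearMap.adjoint j h
  refine ⟨memLp_of_mem_coeffGraph p.2, fun v hv => ?_⟩
  have h1 := ContinuousLinearMap.adjoint_inner_right j ⟨_, toLp_mem_coeffGraph hv⟩ h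
  rw [Submodule.coe_inner, WithLp.prod_inner_apply, L2.inner_def] at h1
  refine Eq.trans ?_ h1
  congr 1
  refine integral_congr_ae ?_
  filter_upwards [hv.coeFn_toLp, mem_coeffGraph.1 p.2] with x h1 h2
  rw [← h1]
  exact congrArg (inner ℂ _) h2.symm

end Gram

/-! ### Orthogonality relations and the formal degree -/

section Orthogonality

variable {G H : Type*} [Group G] [TopologicalSpace G] [IsTopologicalGroup G]
  [MeasurableSpace G] [BorelSpace G]
  [NormedAddCommGroup H] [InnerProductSpace ℂ H] {π : ProjRep G H} {μ : Measure G}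

theorem memLp_coeff_op [μ.IsMulLeftInvariant] {g f : H} (hf : MemLp (π.coeff g f) 2 μ) (x : G) :
    MemLp (π.coeff g (π.op x f)) 2 μ :=
  (hf.comp_measurePreserving (measurePreserving_mul_left μ x⁻¹)).congr_norm
    (π.stronglyMeasurable_coeff _ _).aestronglyMeasurable
    (Eventually.of_forall fun y => (π.norm_coeff_op g f x y).symm)

theorem memLp_coeff_symm [μ.IsMulLeftInvariant] {g f : H} (hf : MemLp (π.coeff g f) 2 μ) (x : G) :
    MemLp (π.coeff g ((π.op x).symm f)) 2 μ := by
  rw [op_symm, coeff_smul_right]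
  exact (memLp_coeff_op hf x⁻¹).const_smul _

theorem memLp_coeff_swap [μ.IsInvInvariant] {g f : H} (hf : MemLp (π.coeff g f) 2 μ) :
    MemLp (π.coeff f g) 2 μ := by
  refine (hf.comp_measurePreserving (Measure.measurePreserving_inv μ)).congr_norm
    (π.stronglyMeasurable_coeff _ _).aestronglyMeasurable (Eventually.of_forall fun x => ?_)
  rw [Function.comp_apply, coeff_inv, norm_mul, norm_mul, Circle.norm_coe, Circle.norm_coe,
    RCLike.norm_conj, one_mul, one_mul]

/-- Both coefficients are translated by `x` and multiplied by the same phase, which cancels in the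
inner product. -/
theorem IsGramSolution.op [μ.IsMulLeftInvariant] {g u h : H} (hu : π.IsGramSolution μ g u h)
    (x : G) : π.IsGramSolution μ g (π.op x u) (π.op x h) := by
  refine ⟨memLp_coeff_op hu.1 x, fun v hv => ?_⟩
  have h1 := hu.2 _ (memLp_coeff_symm hv x)
  set w := (π.op x).symm v
  have hv : v = π.op x w := ((π.op x).apply_symm_apply v).symm
  rw [hv, LinearIsometryEquiv.inner_map_map, LinearIsometryEquiv.inner_map_map, ← h1]
  congr 1
  rw [← integral_mul_left_eq_self (fun y => ⟪π.coeff g w y, π.coeff g u y⟫_ℂ) x⁻¹]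
  refine integral_congr_ae (Eventually.of_forall fun y => ?_)
  dsimp only
  have hσ : (π.σ x (x⁻¹ * y) : ℂ) * conj (π.σ x (x⁻¹ * y) : ℂ) = 1 := by
    rw [RCLike.mul_conj, Circle.norm_coe]
    simp
  rw [coeff_op, coeff_op, RCLike.inner_apply, RCLike.inner_apply, _root_.map_mul, RCLike.conj_conj]
  linear_combination
    (π.coeff g u (x⁻¹ * y) * conj (π.coeff g w (x⁻¹ * y))) * hσ

/-- If `V_g f` is square-integrable for some nonzero `f`, then `V_g` is a multiple of an
isometry into `L²`. -/
theorem IsIrreducible.exists_integral_coeff_eq [CompleteSpace H] [μ.IsMulLeftInvariant]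
    (hπ : π.IsIrreducible) {g f₀ : H} (hf₀ : f₀ ≠ 0) (h₀ : MemLp (π.coeff g f₀) 2 μ) :
    (∀ f, MemLp (π.coeff g f) 2 μ) ∧ ∃ C : ℂ, ∀ f₁ f₂,
      ∫ x, π.coeff g f₁ x * conj (π.coeff g f₂ x) ∂μ = C * ⟪f₂, f₁⟫_ℂ := by
  have : Nontrivial H := ⟨f₀, 0, hf₀⟩
  obtain ⟨T, hT, hsol⟩ := π.exists_isGramSolution (μ := μ) g
  obtain ⟨c, hc⟩ := hπ.exists_eq_smul_of_isSelfAdjoint hT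
    fun x f => (hsol (π.op x f)).unique ((hsol f).op x)
  have hc0 : (c : ℂ) ≠ 0 := by
    intro hc0
    have h1 := (hsol f₀).2 f₀ h₀
    rw [hc, hc0, zero_smul, coeff_zero_right] at h1
    simp only [inner_zero_right, Pi.zero_apply, integral_zero, add_zero] at h1
    exact hf₀ (inner_self_eq_zero.1 h1.symm)
  -- The range of `T` lies in the domain of `V_g`, and `T` is a nonzero scalar, so the domain is all
  -- of `H`.
  have hmem : ∀ f, MemLp (π.coeff g f) 2 μ := by
    intro f
    have h1 := (hsol ((c : ℂ)⁻¹ • f)).1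
    rwa [hc, smul_smul, mul_inv_cancel₀ hc0, one_smul] at h1
  refine ⟨hmem, (c : ℂ)⁻¹ - 1, fun f₁ f₂ => ?_⟩
  have h1 := (hsol ((c : ℂ)⁻¹ • f₁)).2 f₂ (hmem f₂)
  rw [hc, smul_smul, mul_inv_cancel₀ hc0, one_smul, inner_smul_right] at h1
  rw [sub_mul, ← h1, one_mul, add_sub_cancel_left]
  rfl

theorem sesquilinear_eq_zero_of_diag {S : H → H → ℂ}
    (add_left : ∀ a b c, S (a + b) c = S a c + S b c)
    (add_right : ∀ a b c, S a (b + c) = S a b + S a c)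
    (smul_left : ∀ (z : ℂ) a b, S (z • a) b = conj z * S a b)
    (smul_right : ∀ (z : ℂ) a b, S a (z • b) = z * S a b)
    (diag : ∀ a, S a a = 0) (a b : H) : S a b = 0 := by
  have h1 := diag (a + b)
  have h2 := diag (a + Complex.I • b)
  simp only [add_left, add_right, smul_left, smul_right, diag, Complex.conj_I] at h1 h2
  linear_combination (1 / 2) * h1 - (Complex.I / 2) * h2 + (1 / 2 * (S a b - S b a)) * Complex.I_sq

/-- **Orthogonality relations**: a discrete series representation of a unimodular group has a
formal degree. -/
theorem IsDiscreteSeries.exists_isFormalDegree [CompleteSpace H] [LocallyCompactSpace G]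
    [SecondCountableTopology G] [μ.IsHaarMeasure] [μ.IsInvInvariant]
    (hπ : π.IsDiscreteSeries μ) : ∃ d : ℝ, π.IsFormalDegree μ d := by
  obtain ⟨hirr, e, he, hee⟩ := hπ
  have hmem : ∀ g f, MemLp (π.coeff g f) 2 μ := fun g =>
    (hirr.exists_integral_coeff_eq he
      (memLp_coeff_swap ((hirr.exists_integral_coeff_eq he hee).1 g))).1
  choose C hC using fun g => (hirr.exists_integral_coeff_eq he (hmem g e)).2
  -- Substituting `x ↦ x⁻¹` exchanges `f` and `g`; hence `C g` is proportional to `‖g‖²`. This is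
  -- where unimodularity enters.
  have hswap : ∀ f g, C g * ⟪f, f⟫_ℂ = C f * ⟪g, g⟫_ℂ := by
    intro f g
    rw [← hC, ← hC, ← integral_inv_eq_self]
    refine integral_congr_ae (Eventually.of_forall fun x => ?_)
    dsimp only
    rw [coeff_inv, RCLike.mul_conj, RCLike.mul_conj, norm_mul, norm_mul, Circle.norm_coe,
      Circle.norm_coe, RCLike.norm_conj, one_mul, one_mul]
  set c := ∫ x, ‖π.coeff e e x‖ ^ 2 ∂μ
  have hc : C e * ⟪e, e⟫_ℂ = (c : ℂ) := by
    rw [← hC, ← integral_complex_ofReal]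
    refine integral_congr_ae (Eventually.of_forall fun x => ?_)
    dsimp only
    rw [RCLike.mul_conj]
    norm_cast
  have hcpos : 0 < c := by
    have hcont : Continuous fun x => ‖π.coeff e e x‖ ^ 2 := (π.continuous_norm_coeff e e).pow 2
    refine (integral_pos_iff_support_of_nonneg (fun x => by positivity)
      (hee.integrable_norm_pow two_ne_zero)).2 ?_
    refine hcont.isOpen_support.measure_pos μ ⟨1, ?_⟩
    rw [Function.mem_support, norm_coeff_one]
    simpa using he
  have hee0 : ⟪e, e⟫_ℂ ≠ 0 := inner_self_ne_zero.2 he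
  set k : ℝ := c / ‖e‖ ^ 4
  have hk : 0 < k := by
    have : 0 < ‖e‖ := norm_pos_iff.2 he
    positivity
  have hCg : ∀ g, C g = k * ⟪g, g⟫_ℂ := by
    intro g
    have h1 := hswap e g
    have h2 : ⟪e, e⟫_ℂ = (‖e‖ : ℂ) ^ 2 := inner_self_eq_norm_sq_to_K e
    have h3 : (k : ℂ) * ⟪e, e⟫_ℂ ^ 2 = c := by
      have : (‖e‖ : ℂ) ≠ 0 := by simpa using he
      rw [h2]
      simp only [k]
      push_cast
      field_simp
    have h4 : ⟪e, e⟫_ℂ ^ 2 * C g = ⟪e, e⟫_ℂ ^ 2 * (k * ⟪g, g⟫_ℂ) := by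
      linear_combination ⟪e, e⟫_ℂ * h1 + ⟪g, g⟫_ℂ * hc - ⟪g, g⟫_ℂ * h3
    exact mul_left_cancel₀ (pow_ne_zero 2 hee0) h4
  have hint : ∀ f₁ f₂ g₁ g₂ : H,
      Integrable (fun x => ⟪π.op x g₁, f₁⟫_ℂ * ⟪f₂, π.op x g₂⟫_ℂ) μ := by
    intro f₁ f₂ g₁ g₂
    have h2 : MemLp (fun x => ⟪f₂, π.op x g₂⟫_ℂ) 2 μ := by
      refine (hmem g₂ f₂).congr_norm
        (stronglyMeasurable_const.inner (π.stronglyMeasurable g₂)).aestronglyMeasurable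
        (Eventually.of_forall fun x => ?_)
      rw [coeff, norm_inner_symm]
    exact (hmem g₁ f₁).integrable_mul h2
  refine ⟨k⁻¹, inv_pos.2 hk, fun f₁ f₂ g₁ g₂ => ⟨hint f₁ f₂ g₁ g₂, ?_⟩⟩
  rw [inner_conj_symm, ← sub_eq_zero]
  -- The relations are known for `g₁ = g₂`; polarization in the `g` variables gives the rest.
  refine sesquilinear_eq_zero_of_diag (S := fun g₁ g₂ =>
    ∫ x, ⟪π.op x g₁, f₁⟫_ℂ * ⟪f₂, π.op x g₂⟫_ℂ ∂μ -
      ((k⁻¹ : ℝ) : ℂ)⁻¹ * ⟪f₂, f₁⟫_ℂ * ⟪g₁, g₂⟫_ℂ) ?_ ?_ ?_ ?_ ?_ g₁ g₂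
  · intro a b g
    simp only [map_add, inner_add_left, add_mul]
    rw [integral_add (hint _ _ _ _) (hint _ _ _ _)]
    ring
  · intro g a b
    simp only [map_add, inner_add_right, mul_add]
    rw [integral_add (hint _ _ _ _) (hint _ _ _ _)]
    ring
  · intro z a b
    simp only [map_smul, inner_smul_left, mul_assoc]
    rw [integral_const_mul]
    ring
  · intro z a b
    simp only [map_smul, inner_smul_right, mul_left_comm _ z]
    rw [integral_const_mul]
    ring
  · intro g
    have h1 := hC g f₁ f₂
    simp only [coeff, inner_conj_symm] at h1
    rw [h1, hCg]
    push_cast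
    rw [inv_inv]
    ring

end Orthogonality

end ProjRep

/-! ### Exhaustion by compact sets -/

section CompactCovering

variable {G : Type*} [TopologicalSpace G] [T2Space G] [LocallyCompactSpace G]
  [SecondCountableTopology G] [MeasurableSpace G] [BorelSpace G] {μ : Measure G}

theorem tendsto_setLIntegral_compactCovering {ψ : G → ℝ≥0∞} (hψ : AEMeasurable ψ μ) :
    Tendsto (fun n => ∫⁻ x in compactCovering G n, ψ x ∂μ) atTop (𝓝 (∫⁻ x, ψ x ∂μ)) := by
  have hm := fun n => (isCompact_compactCovering G n).measurableSet
  simp_rw [← lintegral_indicator (hm _)]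
  refine lintegral_tendsto_of_tendsto_of_monotone (fun n => hψ.indicator (hm n))
    (Eventually.of_forall fun x m n hmn => ?_) (Eventually.of_forall fun x => ?_)
  · exact Set.indicator_le_indicator_of_subset (compactCovering_subset G hmn) (fun _ => zero_le) x
  · obtain ⟨m, hmx⟩ := exists_mem_compactCovering x
    refine tendsto_const_nhds.congr' ?_
    filter_upwards [eventually_ge_atTop m] with n hn
    rw [Set.indicator_of_mem (compactCovering_subset G hn hmx)]

theorem tendsto_setLIntegral_compl_compactCovering {ψ : G → ℝ≥0∞} (hψ : AEMeasurable ψ μ)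
    (hfin : ∫⁻ x, ψ x ∂μ ≠ ∞) :
    Tendsto (fun n => ∫⁻ x in (compactCovering G n)ᶜ, ψ x ∂μ) atTop (𝓝 0) := by
  have hm := fun n => (isCompact_compactCovering G n).measurableSet.compl
  simp_rw [← lintegral_indicator (hm _)]
  rw [← lintegral_zero (μ := μ)]
  refine lintegral_tendsto_of_tendsto_of_antitone (fun n => hψ.indicator (hm n))
    (Eventually.of_forall fun x m n hmn => ?_)
    (ne_top_of_le_ne_top hfin (lintegral_mono fun x => Set.indicator_le_self _ _ x))
    (Eventually.of_forall fun x => ?_)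
  · exact Set.indicator_le_indicator_of_subset
      (Set.compl_subset_compl.2 (compactCovering_subset G hmn)) (fun _ => zero_le) x
  · obtain ⟨m, hmx⟩ := exists_mem_compactCovering x
    refine tendsto_const_nhds.congr' ?_
    filter_upwards [eventually_ge_atTop m] with n hn
    rw [Set.indicator_of_notMem (Set.notMem_compl_iff.2 (compactCovering_subset G hn hmx))]

end CompactCovering

/-! ### Tail estimates and density bounds without compact support -/

section Tail

variable {G : Type*} [Group G] [TopologicalSpace G] [IsTopologicalGroup G]
  [MeasurableSpace G] [BorelSpace G]
  {μ : Measure G} [μ.IsHaarMeasure] {Λ Q O : Set G} {R : ℝ≥0∞} {F : G → ℂ}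

/-- Since `‖F‖` is continuous and Haar measure charges open sets, the essential supremum dominates
every value at an interior point. -/
theorem enorm_le_localMaximal (hF : Continuous fun x => ‖F x‖) (x : G) {z : G}
    (hz : z ∈ interior Q) : ‖F (x * z)‖ₑ ≤ localMaximal μ Q F x := by
  by_contra! hlt
  have hF' : Continuous fun x => ‖F x‖ₑ := by
    simp_rw [← ofReal_norm]
    exact ENNReal.continuous_ofReal.comp hF
  set U := {w : G | localMaximal μ Q F x < ‖F (x * w)‖ₑ} ∩ interior Q
  have hU : IsOpen U :=
    (isOpen_lt continuous_const (hF'.comp (continuous_const_mul x))).inter isOpen_interior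
  refine (hU.measure_pos μ ⟨z, hlt, hz⟩).ne' ?_
  have h1 : ∀ᵐ w ∂μ.restrict Q, ‖F (x * w)‖ₑ ≤ localMaximal μ Q F x :=
    ae_le_essSup (f := fun w => ‖F (x * w)‖ₑ)
  have h2 : ∀ᵐ w ∂μ.restrict (interior Q), ‖F (x * w)‖ₑ ≤ localMaximal μ Q F x :=
    ae_mono (Measure.restrict_mono interior_subset le_rfl) h1
  rw [ae_restrict_iff' isOpen_interior.measurableSet] at h2
  refine measure_mono_null (fun w hw => ?_) h2
  exact fun h => (h hw.2).not_gt hw.1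

/-- For `x ∈ lO⁻¹` the value at `y⁻¹l` is at most the local maximal function at `y⁻¹x`. Averaging
over `lO⁻¹` and bounded overlap turn the sum into an integral; discarding `CQ` keeps `y⁻¹x` outside
`C`. The bound does not depend on `y`. -/
theorem tsum_indicator_compl_le (hΛ : Λ.Countable) (hO : IsOpen O) (hOQ : O ⊆ interior Q)
    (hR : ∀ x : G, ((Λ ∩ x • O).encard : ℝ≥0∞) ≤ R) (hF : Continuous fun x => ‖F x‖)
    (hM : AEMeasurable (localMaximal μ Q F) μ) {C : Set G} (hC : MeasurableSet C) (y : G) :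
    (∑' l : Λ, (C * Q)ᶜ.indicator (fun x => ‖F x‖ₑ ^ 2) (y⁻¹ * l)) * μ O⁻¹
      ≤ R * ∫⁻ x in Cᶜ, localMaximal μ Q F x ^ 2 ∂μ := by
  set φ : G → ℝ≥0∞ := fun x => localMaximal μ Q F (y⁻¹ * x) ^ 2
  have hφ : AEMeasurable φ μ :=
    (hM.comp_quasiMeasurePreserving
      (measurePreserving_mul_left μ y⁻¹).quasiMeasurePreserving).pow_const 2
  set S := y • (C * Q)ᶜ
  have hSO : S * O⁻¹ ⊆ y • Cᶜ := by
    rintro _ ⟨s, hs, o, ho, rfl⟩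
    rw [Set.mem_smul_set_iff_inv_smul_mem, smul_eq_mul] at hs ⊢
    intro hc
    exact hs ⟨_, hc, o⁻¹, interior_subset (hOQ ho), by simp [mul_assoc]⟩
  calc _ ≤ ∑' l : Λ, S.indicator (fun l => ∫⁻ x in l • O⁻¹, φ x ∂μ) (l : G) := by
        rw [← ENNReal.tsum_mul_right]
        refine ENNReal.tsum_le_tsum fun l => ?_
        by_cases hl : y⁻¹ * (l : G) ∈ (C * Q)ᶜ
        · rw [Set.indicator_of_mem hl,
            Set.indicator_of_mem (by rwa [Set.mem_smul_set_iff_inv_smul_mem]),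
            ← measure_smul μ (l : G), ← setLIntegral_const]
          refine setLIntegral_mono' (hO.inv.smul (l : G)).measurableSet fun x hx => ?_
          have hx' := (mem_smul_iff_mem_smul_inv (O := O)).2 hx
          rw [Set.mem_smul_set_iff_inv_smul_mem, smul_eq_mul] at hx'
          have := enorm_le_localMaximal (μ := μ) hF (y⁻¹ * x) (hOQ hx')
          rw [show y⁻¹ * x * (x⁻¹ * l) = y⁻¹ * l by group] at this
          exact pow_le_pow_left' this 2
        · rw [Set.indicator_of_notMem hl, zero_mul]
          exact zero_le
    _ ≤ R * ∫⁻ x in S * O⁻¹, φ x ∂μ := tsum_setLIntegral_smul_le hΛ hO hR hφ S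
    _ ≤ R * ∫⁻ x in y • Cᶜ, φ x ∂μ := by gcongr
    _ = R * ∫⁻ x in Cᶜ, localMaximal μ Q F x ^ 2 ∂μ := by
        congr 1
        rw [← lintegral_indicator (hC.compl.const_smul y), ← lintegral_indicator hC.compl,
          ← lintegral_mul_left_eq_self (Cᶜ.indicator fun x => localMaximal μ Q F x ^ 2) y⁻¹]
        refine lintegral_congr fun x => ?_
        by_cases hx : x ∈ y • Cᶜ
        · rw [Set.indicator_of_mem hx,
            Set.indicator_of_mem (by rwa [Set.mem_smul_set_iff_inv_smul_mem] at hx)]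
        · rw [Set.indicator_of_notMem hx,
            Set.indicator_of_notMem (by rwa [Set.mem_smul_set_iff_inv_smul_mem] at hx)]

variable [T2Space G] [LocallyCompactSpace G] [SecondCountableTopology G]
  [μ.IsInvInvariant] {b a : ℝ≥0∞}

/-- Upper bound of the density through the integral of a covering function. -/
theorem HasUpperDensity.mul_lintegral_le (hΛ : Λ.Countable) (hsep : IsRelativelySeparated Λ)
    {D : ℝ≥0} (hD : HasUpperDensity μ Λ D) {ψ : G → ℝ≥0∞} (hψ : Measurable ψ)
    (hfin : ∫⁻ x, ψ x ∂μ ≠ ∞) (hb : ∀ y : G, ∑' l : Λ, ψ (y⁻¹ * l) ≤ b) :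
    D * ∫⁻ x, ψ x ∂μ ≤ b := by
  obtain ⟨K, hK⟩ := hD.1
  refine le_of_tendsto' (ENNReal.Tendsto.const_mul
    (tendsto_setLIntegral_compactCovering hψ.aemeasurable) (.inr ENNReal.coe_ne_top)) fun n => ?_
  have hc := isCompact_compactCovering G n
  rw [← lintegral_indicator hc.measurableSet]
  by_cases h0 : ∫⁻ x, (compactCovering G n).indicator ψ x ∂μ = 0
  · rw [h0, mul_zero]; exact zero_le
  have ht : ∫⁻ x, (compactCovering G n).indicator ψ x ∂μ ≠ ∞ :=
    ne_top_of_le_ne_top hfin (lintegral_mono fun x => Set.indicator_le_self _ _ x)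
  have h := hK.limsup_iSup_le hΛ hsep hc (hψ.indicator hc.measurableSet)
    (fun x hx => Set.indicator_of_notMem hx _) h0 ht (b := b)
    (fun y => (ENNReal.tsum_le_tsum fun l => Set.indicator_le_self _ _ _).trans (hb y))
  rwa [(hD.2 K hK).limsup_eq, ENNReal.le_div_iff_mul_le (.inl h0) (.inl ht)] at h

/-- Lower bound of the density through the integral of a covering function whose local maximal
function is square-integrable. -/
theorem HasLowerDensity.le_mul_lintegral (hΛ : Λ.Countable) (hsep : IsRelativelySeparated Λ)
    (hQ : IsCompact Q) (hQ_nhds : Q ∈ 𝓝 (1 : G)) {D : ℝ≥0} (hD : HasLowerDensity μ Λ D)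
    (hF : Continuous fun x => ‖F x‖) (hM : MemLp (localMaximal μ Q F) 2 μ)
    (hfin : ∫⁻ x, ‖F x‖ₑ ^ 2 ∂μ ≠ ∞) (ha : ∀ y : G, a ≤ ∑' l : Λ, ‖F (y⁻¹ * l)‖ₑ ^ 2) :
    a ≤ D * ∫⁻ x, ‖F x‖ₑ ^ 2 ∂μ := by
  obtain ⟨K, hK⟩ := hD.1
  have ⟨O', hO', h1O', R, hR'⟩ := hsep
  set O := O' ∩ interior Q
  have hO : IsOpen O := hO'.inter isOpen_interior
  have h1O : (1 : G) ∈ O := ⟨h1O', mem_interior_iff_mem_nhds.2 hQ_nhds⟩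
  have hR : ∀ x : G, ((Λ ∩ x • O).encard : ℝ≥0∞) ≤ R := fun x =>
    (encard_inter_mono Λ (Set.smul_set_mono Set.inter_subset_left)).trans (hR' x)
  have hO0 : μ O⁻¹ ≠ 0 := by
    rw [Measure.measure_inv]; exact (hO.measure_pos μ ⟨1, h1O⟩).ne'
  have hOt : μ O⁻¹ ≠ ∞ := by
    rw [Measure.measure_inv]
    exact ((measure_mono (Set.inter_subset_right.trans interior_subset)).trans_lt
      hQ.measure_lt_top).ne
  have hF2 : Measurable fun x => ‖F x‖ₑ ^ 2 := by
    simp_rw [← ofReal_norm]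
    exact (ENNReal.continuous_ofReal.comp hF).measurable.pow_const 2
  have hMm : AEMeasurable (localMaximal μ Q F) μ := hM.1.aemeasurable
  have hM2 : ∫⁻ x, localMaximal μ Q F x ^ 2 ∂μ ≠ ∞ := by
    have := lintegral_rpow_enorm_lt_top_of_eLpNorm_lt_top two_ne_zero ENNReal.ofNat_ne_top hM.2
    simpa using this.ne
  set t : ℕ → ℝ≥0∞ := fun n =>
    R * (∫⁻ x in (compactCovering G n)ᶜ, localMaximal μ Q F x ^ 2 ∂μ) / μ O⁻¹
  have ht : Tendsto t atTop (𝓝 0) := by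
    have h := ENNReal.Tendsto.div_const (ENNReal.Tendsto.const_mul
      (tendsto_setLIntegral_compl_compactCovering (hMm.pow_const 2) hM2)
      (.inr (ENNReal.coe_ne_top (r := R)))) (b := μ O⁻¹) (.inr hO0)
    rwa [mul_zero, ENNReal.zero_div] at h
  have ht' := ht.const_add (D * ∫⁻ x, ‖F x‖ₑ ^ 2 ∂μ)
  rw [add_zero] at ht'
  refine ge_of_tendsto' ht' fun n => ?_
  set C := compactCovering G n
  have hC : IsCompact C := isCompact_compactCovering G n
  have hCQ : IsCompact (C * Q) := hC.mul hQ
  -- Truncation to `CQ` costs at most the tail `t n`, uniformly in `y`.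
  have hsum : ∀ y : G, a - t n ≤
      ∑' l : Λ, (C * Q).indicator (fun x => ‖F x‖ₑ ^ 2) (y⁻¹ * l) := by
    intro y
    rw [tsub_le_iff_right]
    have h1 : ∑' l : Λ, (C * Q)ᶜ.indicator (fun x => ‖F x‖ₑ ^ 2) (y⁻¹ * l) ≤ t n := by
      rw [ENNReal.le_div_iff_mul_le (.inl hO0) (.inl hOt)]
      exact tsum_indicator_compl_le hΛ hO Set.inter_subset_right hR hF hMm hC.measurableSet y
    refine (ha y).trans (le_trans (le_of_eq ?_) (add_le_add_right h1 _))
    rw [← ENNReal.tsum_add]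
    exact tsum_congr fun l =>
      (Set.indicator_self_add_compl_apply (C * Q) (fun x => ‖F x‖ₑ ^ 2) _).symm
  have hle : ∫⁻ x, (C * Q).indicator (fun x => ‖F x‖ₑ ^ 2) x ∂μ ≤ ∫⁻ x, ‖F x‖ₑ ^ 2 ∂μ :=
    lintegral_mono fun x => Set.indicator_le_self _ _ x
  have hIt := ne_top_of_le_ne_top hfin hle
  have h := hK.le_liminf_iInf hΛ hsep hCQ (hF2.indicator hCQ.measurableSet)
    (fun x hx => Set.indicator_of_notMem hx _) hsum
  rw [(hD.2 K hK).liminf_eq] at h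
  rw [← tsub_le_iff_right]
  refine le_trans ?_ (mul_le_mul_right hle _)
  -- A zero integral with `a - t n` positive would make the quotient infinite, contradicting `D <
  -- ∞`.
  by_cases hI : ∫⁻ x, (C * Q).indicator (fun x => ‖F x‖ₑ ^ 2) x ∂μ = 0
  · by_contra! hlt
    rw [hI, ENNReal.div_zero (ne_bot_of_gt hlt)] at h
    exact ENNReal.coe_ne_top (top_le_iff.1 h)
  · exact (ENNReal.div_le_iff hI hIt).1 h

end Tail

/-! ### Consequences of the frame inequality -/

namespace ProjRep

section Frame

variable {G H : Type*} [Group G] [MeasurableSpace G]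
  [NormedAddCommGroup H] [InnerProductSpace ℂ H] {π : ProjRep G H} {Λ : Set G} {g : H} {A B : ℝ}

theorem IsFrame.tsum_enorm_sq (h : π.IsFrame Λ g A B) (f : H) :
    ∑' l : Λ, ‖π.coeff g f l‖ₑ ^ 2 = ENNReal.ofReal (∑' l : Λ, ‖π.coeff g f l‖ ^ 2) := by
  rw [ENNReal.ofReal_tsum_of_nonneg (fun l => sq_nonneg _) (h.summable f)]
  refine tsum_congr fun l => ?_
  rw [ENNReal.ofReal_pow (norm_nonneg _), ofReal_norm]

theorem IsFrame.tsum_enorm_translate (h : π.IsFrame Λ g A B) (y : G) :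
    ∑' l : Λ, ‖π.coeff g g (y⁻¹ * l)‖ₑ ^ 2 =
      ENNReal.ofReal (∑' l : Λ, ‖π.coeff g (π.op y g) l‖ ^ 2) := by
  rw [← h.tsum_enorm_sq]
  refine tsum_congr fun l => ?_
  rw [← ofReal_norm, ← ofReal_norm, norm_coeff_op]

theorem IsFrame.tsum_translate_le (h : π.IsFrame Λ g A B) (y : G) :
    ∑' l : Λ, ‖π.coeff g g (y⁻¹ * l)‖ₑ ^ 2 ≤ ENNReal.ofReal (B * ‖g‖ ^ 2) := by
  rw [h.tsum_enorm_translate]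
  refine ENNReal.ofReal_le_ofReal ?_
  have := h.upper (π.op y g)
  rwa [LinearIsometryEquiv.norm_map] at this

theorem IsFrame.le_tsum_translate (h : π.IsFrame Λ g A B) (y : G) :
    ENNReal.ofReal (A * ‖g‖ ^ 2) ≤ ∑' l : Λ, ‖π.coeff g g (y⁻¹ * l)‖ₑ ^ 2 := by
  rw [h.tsum_enorm_translate]
  refine ENNReal.ofReal_le_ofReal ?_
  have := h.lower (π.op y g)
  rwa [LinearIsometryEquiv.norm_map] at this

theorem IsFrame.ne_zero [Nontrivial H] (h : π.IsFrame Λ g A B) : g ≠ 0 := by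
  rintro rfl
  obtain ⟨f, hf⟩ := exists_ne (0 : H)
  have h1 := h.lower f
  have h2 : ∀ x, π.coeff 0 f x = 0 := fun x => by simp [coeff]
  simp only [h2, norm_zero, ne_eq, OfNat.ofNat_ne_zero, not_false_eq_true, zero_pow,
    tsum_zero] at h1
  have := mul_pos h.lower_pos (pow_pos (norm_pos_iff.2 hf) 2)
  linarith

/-- `|V_g g|` exceeds `‖g‖²/2` on a neighbourhood `O` of the identity, so each point of `Λ ∩ xO`
adds at least `‖g‖⁴/4` to a sum bounded by `B‖g‖²`. -/
theorem IsFrame.isRelativelySeparated [TopologicalSpace G] [IsTopologicalGroup G]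
    [LocallyCompactSpace G] [SecondCountableTopology G] [BorelSpace G] (hg : g ≠ 0)
    (h : π.IsFrame Λ g A B) : IsRelativelySeparated Λ := by
  have hg' : 0 < ‖g‖ := norm_pos_iff.2 hg
  set O := {x : G | ‖g‖ ^ 2 / 2 < ‖π.coeff g g x‖}
  set c : ℝ≥0∞ := ENNReal.ofReal (‖g‖ ^ 2 / 2) ^ 2
  have hc0 : c ≠ 0 := pow_ne_zero 2 (ENNReal.ofReal_pos.2 (by positivity)).ne'
  have hct : c ≠ ∞ := ENNReal.pow_ne_top ENNReal.ofReal_ne_top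
  refine ⟨O, isOpen_lt continuous_const (π.continuous_norm_coeff g g), ?_,
    (ENNReal.ofReal (B * ‖g‖ ^ 2) / c).toNNReal, fun x => ?_⟩
  · change _ < ‖π.coeff g g 1‖
    rw [norm_coeff_one, inner_self_eq_norm_sq_to_K, norm_pow, RCLike.norm_ofReal, abs_norm]
    linarith [pow_pos hg' 2]
  · rw [ENNReal.coe_toNNReal (ENNReal.div_ne_top ENNReal.ofReal_ne_top hc0),
      ENNReal.le_div_iff_mul_le (.inl hc0) (.inl hct), ← tsum_indicator_inv_mul,
      ← ENNReal.tsum_mul_right]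
    refine (ENNReal.tsum_le_tsum fun l => ?_).trans (h.tsum_translate_le x)
    by_cases hl : x⁻¹ * (l : G) ∈ O
    · rw [Set.indicator_of_mem hl, Pi.one_apply, one_mul, ← ofReal_norm]
      exact pow_le_pow_left' (ENNReal.ofReal_le_ofReal hl.le) 2
    · rw [Set.indicator_of_notMem hl, zero_mul]
      exact zero_le

theorem IsFormalDegree.lintegral_enorm_coeff_sq {μ : Measure G} {d : ℝ}
    (hd : π.IsFormalDegree μ d) (g : H) :
    ∫⁻ x, ‖π.coeff g g x‖ₑ ^ 2 ∂μ = ENNReal.ofReal (d⁻¹ * ‖g‖ ^ 4) := by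
  obtain ⟨hint, heq⟩ := hd.2 g g g g
  have e : ∀ x, inner ℂ (π.op x g) g * inner ℂ g (π.op x g) = ((‖π.coeff g g x‖ ^ 2 : ℝ) : ℂ) := by
    intro x
    rw [← inner_conj_symm g, RCLike.mul_conj, coeff]
    norm_cast
  simp_rw [e] at hint heq
  have hint' : Integrable (fun x => ‖π.coeff g g x‖ ^ 2) μ := hint.re
  have h1 : ∫ x, ‖π.coeff g g x‖ ^ 2 ∂μ = d⁻¹ * ‖g‖ ^ 4 := by
    rw [integral_complex_ofReal, inner_conj_symm, inner_self_eq_norm_sq_to_K] at heq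
    have h2 : ((∫ x, ‖π.coeff g g x‖ ^ 2 ∂μ : ℝ) : ℂ) = ((d⁻¹ * ‖g‖ ^ 4 : ℝ) : ℂ) := by
      rw [heq]
      push_cast
      change (d : ℂ)⁻¹ * (‖g‖ : ℂ) ^ 2 * (‖g‖ : ℂ) ^ 2 = _
      ring
    exact_mod_cast h2
  rw [← h1, ofReal_integral_eq_lintegral_ofReal hint' (Eventually.of_forall fun x => sq_nonneg _)]
  refine lintegral_congr fun x => ?_
  rw [ENNReal.ofReal_pow (norm_nonneg _), ofReal_norm]

end Frame

end ProjRep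

end CoherentFrame

/-! ### The density theorem -/

theorem corollary3p5
    {G : Type*} [Group G] [TopologicalSpace G] [IsTopologicalGroup G] [T2Space G]
    [LocallyCompactSpace G] [SecondCountableTopology G] [MeasurableSpace G] [BorelSpace G]
    (μ : Measure G) [μ.IsHaarMeasure] [μ.IsMulRightInvariant] (hG : IsAmenable μ)
    (Q : Set G) (hQ : IsCompact Q) (hQ_nhds : Q ∈ 𝓝 (1 : G)) (hQ_symm : Q⁻¹ = Q)
    {H : Type*} [NormedAddCommGroup H] [InnerProductSpace ℂ H] [CompleteSpace H]
    (π : ProjRep G H) (hπ : π.IsDiscreteSeries μ)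
    (Λ : Set G) (hΛ : IsDiscrete Λ) (g : H) (hg : g ∈ π.B2 μ Q)
    (A B : ℝ) (hframe : π.IsFrame Λ g A B) :
    ∃ (d : ℝ) (Dlow Dup : ℝ≥0),
      π.IsFormalDegree μ d ∧ HasLowerDensity μ Λ Dlow ∧ HasUpperDensity μ Λ Dup ∧
      A ≤ d⁻¹ * Dlow * ‖g‖ ^ 2 ∧
      d⁻¹ * Dlow * ‖g‖ ^ 2 ≤ d⁻¹ * Dup * ‖g‖ ^ 2 ∧
      d⁻¹ * Dup * ‖g‖ ^ 2 ≤ B ∧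
      (A = B → Dlow = Dup) := by
  have := isInvInvariant_of_isMulRightInvariant μ
  obtain ⟨e, he, -⟩ := hπ.2
  have : Nontrivial H := ⟨e, 0, he⟩
  have hg0 : g ≠ 0 := hframe.ne_zero
  have hgpos : 0 < ‖g‖ := norm_pos_iff.2 hg0
  have hcount : Λ.Countable := by
    have := hΛ.to_subtype
    exact Set.countable_coe_iff.1 (TopologicalSpace.separableSpace_iff_countable.1 inferInstance)
  have hsep := hframe.isRelativelySeparated hg0
  have hstrong : ∃ K : ℕ → Set G, IsStrongFolner μ K := by
    obtain ⟨K, hK⟩ := hG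
    exact ⟨_, hK.isStrongFolner_mul hQ hQ_nhds hQ_symm⟩
  obtain ⟨d, hd⟩ := hπ.exists_isFormalDegree
  obtain ⟨Dlow, hlow⟩ := exists_hasLowerDensity hcount hsep hstrong
  obtain ⟨Dup, hup⟩ := exists_hasUpperDensity hcount hsep hstrong
  have hI := hd.lintegral_enorm_coeff_sq g
  have hfin : ∫⁻ x, ‖π.coeff g g x‖ₑ ^ 2 ∂μ ≠ ∞ := by rw [hI]; exact ENNReal.ofReal_ne_top
  have hcont := π.continuous_norm_coeff g g
  have h1 := hlow.le_mul_lintegral hcount hsep hQ hQ_nhds hcont hg.memLp hfin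
    hframe.le_tsum_translate
  have h2 := hup.mul_lintegral_le hcount hsep (ψ := fun x => ‖π.coeff g g x‖ₑ ^ 2)
    ((π.stronglyMeasurable_coeff g g).enorm.pow_const 2) hfin hframe.tsum_translate_le
  have hd' : 0 < d⁻¹ := inv_pos.2 hd.1
  rw [hI, ← ENNReal.ofReal_coe_nnreal, ← ENNReal.ofReal_mul (by positivity)] at h1 h2
  rw [ENNReal.ofReal_le_ofReal_iff (by positivity)] at h1
  rw [ENNReal.ofReal_le_ofReal_iff (by have := hframe.upper_pos; positivity)] at h2
  have hg2 : 0 < ‖g‖ ^ 2 := by positivity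
  -- The covering bounds carry `‖g‖²` and the integral `‖g‖⁴`; one factor `‖g‖²` cancels.
  have hA : A ≤ d⁻¹ * Dlow * ‖g‖ ^ 2 := le_of_mul_le_mul_right (by linarith) hg2
  have hB : d⁻¹ * Dup * ‖g‖ ^ 2 ≤ B := le_of_mul_le_mul_right (by linarith) hg2
  have hle : Dlow ≤ Dup := hlow.le_of_hasUpperDensity hup
  have hle' : (Dlow : ℝ) ≤ Dup := hle
  refine ⟨d, Dlow, Dup, hd, hlow, hup, hA, by gcongr, hB, fun hAB => le_antisymm hle ?_⟩
  have h3 : d⁻¹ * ‖g‖ ^ 2 * (Dup : ℝ) ≤ d⁻¹ * ‖g‖ ^ 2 * Dlow := by linarith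
  have h4 : (Dup : ℝ) ≤ Dlow := le_of_mul_le_mul_left h3 (by positivity)
  exact h4
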